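/- Let $\mathbb{F}_4$ be the field with four elements, with conjugation $\overline{\alpha}=\alpha^2$. A quaternary $[m,k,d]$ code is a $k$-dimensional subspace $C$ of $\mathbb{F}_4^m$ whose minimum weight, i.e. the least number of nonzero coordinates of a nonzero vector of $C$, equals $d$. It is Hermitian LCD (linear complementary dual) if $C\cap C^{\perp_H}=\{0\}$, where $C^{\perp_H}=\{x\in\mathbb{F}_4^m : \sum_{i=1}^m x_i\overline{y_i}=0 \text{ for all } y\in C\}$. Let $$\mathcal{P}'_4=\left\{\begin{array}{l} (21,8,9),(21,10,8),(21,11,7),(22,8,10),(23,18,4),(24,16,6),(25,18,4),\\ (25,19,4),(26,16,6),(26,17,6),(26,20,4),(26,21,4),(27,21,4),(27,22,4),\\ (28,21,4),(28,22,4),(28,23,4),(29,22,4),(29,23,4),(30,23,4),(30,24,4) \end{array}\right\}.$$ For every $(n,k,d)\in\mathcal{P}'_4$ and every integer $s\ge 0$, there is a quaternary Hermitian LCD $\left[n+\frac{4^k-1}{3}s,\;k,\;d+4^{k-1}s\right]$ code. -/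

import Mathlib

namespace QuaternaryLCD

/-- The Hermitian inner product `∑ xᵢ ȳᵢ`, with `ȳ = y ^ q`, on vectors over a field of
order `q ^ 2`. -/
def hermInner {F : Type*} [Field F] (q : ℕ) {n : ℕ} (x y : Fin n → F) : F :=
  ∑ i, x i * y i ^ q

/-- The Hermitian dual code: all `x` with `hermInner q x y = 0` for every `y ∈ C`. -/
def hermDual {F : Type*} [Field F] (q : ℕ) {n : ℕ} (C : Submodule F (Fin n → F)) :
    Submodule F (Fin n → F) where
  carrier := {x | ∀ y ∈ C, hermInner q x y = 0}
  zero_mem' := fun y _ => by simp [hermInner]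
  add_mem' := fun {a b} ha hb y hy => by
    have h1 := ha y hy
    have h2 := hb y hy
    simp only [hermInner] at h1 h2 ⊢
    simp only [Pi.add_apply, add_mul, Finset.sum_add_distrib, h1, h2, add_zero]
  smul_mem' := fun c a ha y hy => by
    have h1 := ha y hy
    simp only [hermInner] at h1 ⊢
    simp only [Pi.smul_apply, smul_eq_mul, mul_assoc, ← Finset.mul_sum, h1, mul_zero]

/-- A code over a field of order `q ^ 2` is Hermitian linear complementary dual if it meets its
Hermitian dual only in the zero vector. -/
def IsHermitianLCD {F : Type*} [Field F] (q : ℕ) {n : ℕ} (C : Submodule F (Fin n → F)) : Prop :=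
  C ⊓ hermDual q C = ⊥

/-- `C` has minimum weight `d`: `d` is the least weight of a nonzero codeword. -/
def HasMinWeight {F : Type*} [Field F] [DecidableEq F] {n : ℕ} (C : Submodule F (Fin n → F))
    (d : ℕ) : Prop :=
  IsLeast {w : ℕ | ∃ x ∈ C, x ≠ 0 ∧ hammingNorm x = w} d

/-- `C ⊆ F ^ n` is an `[n, k, d]` code: it has dimension `k` and minimum weight exactly `d`. -/
def IsCode {F : Type*} [Field F] [DecidableEq F] (n k d : ℕ) (C : Submodule F (Fin n → F)) :
    Prop :=
  Module.finrank F C = k ∧ HasMinWeight C d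

/-- The list of 21 parameter triples `(n, k, d)`. -/
def paramSet : Set (ℕ × ℕ × ℕ) :=
  {(21, 8, 9), (21, 10, 8), (21, 11, 7), (22, 8, 10), (23, 18, 4),
   (24, 16, 6), (25, 18, 4), (25, 19, 4), (26, 16, 6), (26, 17, 6),
   (26, 20, 4), (26, 21, 4), (27, 21, 4), (27, 22, 4), (28, 21, 4),
   (28, 22, 4), (28, 23, 4), (29, 22, 4), (29, 23, 4), (30, 23, 4),
   (30, 24, 4)}

end QuaternaryLCD

/-! The case of general `s` follows from `s = 0` by appending copies of the simplex code, and the 21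
base codes are explicit.

Extension (`exists_simplex_extension`): the coordinates of the simplex code are the points of the
projective space of the dual of `C`. A nonzero codeword gives a nonzero linear form on this dual,
hence weight exactly `4 ^ (k - 1)` (`card_nonvanishing_points`). Nonzero cubes in the field are `1`,
so the sum of the cubes of the entries is this weight, which is zero in characteristic two when `k ≥
2`; polarization (`sum_mul_sq_eq_zero`) makes the simplex code Hermitian self-orthogonal. Appending
it thus shifts all weights equally and leaves the Hermitian form on `C` unchanged.

Base codes (`Certificate.exists_code`): codewords `b j` with `⟨g i, b j⟩ = δ i j` for the generator
rows `g i` prove independence of the rows and the LCD property together. The lower bound on weights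
(`Certificate.le_hammingNorm`) is the Brouwer–Zimmermann argument: with several systematic generator
matrices, a word of weight below `d` meets some information set in few positions, so it is a
combination of few rows of that matrix, and these are enumerated. An explicit word attains `d`. -/

namespace QuaternaryLCD

/-! ### The field of four elements -/

/-- `ω` is a root of `X ^ 2 + X + 1`, and `0, 1, ω, ω + 1` exhaust the field `F` of
characteristic two. -/
structure IsGenerator {F : Type*} [Field F] (ω : F) : Prop where
  two_eq_zero : (2 : F) = 0
  mul_self : ω * ω = ω + 1
  cases : ∀ x : F, x = 0 ∨ x = 1 ∨ x = ω ∨ x = ω + 1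

/-- Since nonzero elements have cube `1`, every element other than `0` and `1` is a root of `X ^ 2 +
X + 1`. In characteristic two this polynomial is `(X - ω) * (X - (ω + 1))` for any root `ω`, which
leaves only `ω` and `ω + 1`. -/
theorem exists_isGenerator {F : Type*} [Field F] [Fintype F] (hF : Fintype.card F = 4) :
    ∃ ω : F, IsGenerator ω := by
  classical
  have h2 : (2 : F) = 0 := by
    have h : ((Fintype.card F : ℕ) : F) = 0 := FiniteField.cast_card_eq_zero F
    rw [hF] at h
    have h' : (2 : F) * 2 = 0 := by push_cast at h; linear_combination h
    rcases mul_eq_zero.mp h' with h | h <;> exact h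
  have hcube : ∀ x : F, x ≠ 0 → x ^ 3 = 1 := fun x hx => by
    have := FiniteField.pow_card_sub_one_eq_one x hx
    rwa [hF] at this
  obtain ⟨ω, hω⟩ : ∃ ω : F, ω ∉ ({0, 1} : Finset F) := by
    by_contra! h
    have h1 : (Finset.univ : Finset F) ⊆ {0, 1} := fun x _ => h x
    have h3 := Finset.card_le_card h1
    have h4 : ({0, 1} : Finset F).card ≤ 2 := Finset.card_le_two
    rw [Finset.card_univ, hF] at h3
    omega
  simp only [Finset.mem_insert, Finset.mem_singleton, not_or] at hω
  have key : ∀ x : F, x ≠ 0 → x ≠ 1 → x * x + x + 1 = 0 := fun x h0 h1 => by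
    have h3 := hcube x h0
    have : (x - 1) * (x * x + x + 1) = 0 := by linear_combination h3
    exact (mul_eq_zero.mp this).resolve_left (sub_ne_zero.mpr h1)
  have hω' := key ω hω.1 hω.2
  refine ⟨ω, h2, by linear_combination hω' - (ω + 1) * h2, fun x => ?_⟩
  by_cases h0 : x = 0
  · exact Or.inl h0
  by_cases h1 : x = 1
  · exact Or.inr (Or.inl h1)
  have hx := key x h0 h1
  have : (x - ω) * (x - (ω + 1)) = 0 := by
    linear_combination hx + hω' - (x + ω * x + 1) * h2
  rcases mul_eq_zero.mp this with h | h
  · exact Or.inr (Or.inr (Or.inl (sub_eq_zero.mp h)))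
  · exact Or.inr (Or.inr (Or.inr (sub_eq_zero.mp h)))

/-! ### Weights and Hermitian products by bit arithmetic -/

section Packed

/-! A vector over the field of four elements is packed into a pair `(a, b)` of bit masks: its
`i`-th entry is `aᵢ + bᵢ ω`. -/

/-- The field element `a + b ω` for bits `a` and `b`. -/
def ofBits {F : Type*} [Field F] (ω : F) (a b : Bool) : F :=
  (if a then 1 else 0) + (if b then ω else 0)

/-- The vector of length `n` packed in the pair of bit masks `r`. -/
def unpack {F : Type*} [Field F] (ω : F) (n : ℕ) (r : ℕ × ℕ) : Fin n → F :=
  fun i => ofBits ω (r.1.testBit i) (r.2.testBit i)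

/-- Addition of packed vectors. -/
def padd (r t : ℕ × ℕ) : ℕ × ℕ := (r.1 ^^^ t.1, r.2 ^^^ t.2)

/-- Multiplication of a packed vector by `ω`. -/
def pmul (r : ℕ × ℕ) : ℕ × ℕ := (r.2, r.1 ^^^ r.2)

/-- Multiplication of a packed vector by `a + b ω`. -/
def psmul : Bool → Bool → ℕ × ℕ → ℕ × ℕ
  | false, false, _ => (0, 0)
  | true, false, r => r
  | false, true, r => pmul r
  | true, true, r => pmul (pmul r)

/-- `weightGE d y` implies that the bit mask `y` has at least `d` ones. -/
def weightGE (d : ℕ) : ℕ → Bool :=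
  Nat.rec (fun _ => true) (fun _ f y => Nat.casesOn y false fun z => f ((z + 1) &&& z)) d

/-- The combinations of `r` with at most `w` of the rows in the list have weight at least `d`. -/
def sumsGE {ι : Type*} (n d : ℕ) (L : List (ι × ℕ × ℕ)) : ℕ → ℕ × ℕ → Bool :=
  List.rec (fun _ r => weightGE d ((r.1 ||| r.2) % 2 ^ n))
    (fun p _ f w r => Nat.casesOn w (weightGE d ((r.1 ||| r.2) % 2 ^ n)) fun w =>
      f (w + 1) r && (f w (padd r p.2) && (f w (padd r (pmul p.2)) &&
        f w (padd r (pmul (pmul p.2)))))) L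

/-- The nontrivial combinations of at most `w` of the rows in the list have weight at least
`d`. -/
def combosGE {ι : Type*} (n d : ℕ) : List (ι × ℕ × ℕ) → ℕ → Bool
  | [], _ => true
  | _ :: _, 0 => true
  | (_, t) :: L, w + 1 => combosGE n d L (w + 1) && sumsGE n d L w t

/-- The combination of the rows in the list whose coefficients are the entries of `x` at the
given positions. -/
def recombine {n : ℕ} (x : ℕ × ℕ) : List (Fin n × ℕ × ℕ) → ℕ × ℕ
  | [] => (0, 0)
  | (i, t) :: L => padd (psmul (x.1.testBit i) (x.2.testBit i) t) (recombine x L)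

/-- The parity of the lowest `2 ^ j` bits of `y`. -/
def parity : ℕ → ℕ → Bool
  | 0, y => y.testBit 0
  | j + 1, y => parity j (y ^^^ (y >>> 2 ^ j))

/-- The bits of the Hermitian inner product of two packed vectors of length `n ≤ 32`. -/
def pherm (n : ℕ) (r t : ℕ × ℕ) : Bool × Bool :=
  (parity 5 (((r.1 &&& (t.1 ^^^ t.2)) ^^^ (r.2 &&& t.2)) % 2 ^ n),
   parity 5 (((r.1 &&& t.2) ^^^ (r.2 &&& t.1)) % 2 ^ n))

variable {F : Type*} [Field F] {ω : F}

theorem IsGenerator.add_self (hω : IsGenerator ω) (x : F) : x + x = 0 := by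
  linear_combination x * hω.two_eq_zero

theorem IsGenerator.ne_zero (hω : IsGenerator ω) : ω ≠ 0 := by
  rintro rfl
  simpa using hω.mul_self

theorem IsGenerator.add_one_ne_zero (hω : IsGenerator ω) : ω + 1 ≠ 0 := by
  rw [← hω.mul_self]
  exact mul_ne_zero hω.ne_zero hω.ne_zero

theorem ofBits_xor (hω : IsGenerator ω) (a b c d : Bool) :
    ofBits ω (a ^^ c) (b ^^ d) = ofBits ω a b + ofBits ω c d := by
  have h1 := hω.add_self 1
  have h2 := hω.add_self ω
  cases a <;> cases b <;> cases c <;> cases d <;> simp [ofBits] <;>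
    first | linear_combination -h1 | linear_combination -h2 | linear_combination -h1 - h2 | ring

theorem mul_ofBits (hω : IsGenerator ω) (a b : Bool) :
    ω * ofBits ω a b = ofBits ω b (a ^^ b) := by
  have h0 := hω.mul_self
  have h2 := hω.add_self ω
  cases a <;> cases b <;> simp [ofBits] <;>
    first | linear_combination h0 | linear_combination h0 + h2

theorem ofBits_eq_zero_iff (hω : IsGenerator ω) (a b : Bool) :
    ofBits ω a b = 0 ↔ (a || b) = false := by
  have h1 := hω.ne_zero
  have h2 := hω.add_one_ne_zero
  rw [add_comm] at h2
  cases a <;> cases b <;> simp [ofBits, h1, h2]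

/-- The conjugate of `c + d ω` is `(c + d) + d ω`, because `ω ^ 2 = ω + 1`; the right side is the
expanded product. -/
theorem ofBits_herm (hω : IsGenerator ω) (a b c d : Bool) :
    ofBits ω a b * ofBits ω c d ^ 2 =
      ofBits ω ((a && (c ^^ d)) ^^ (b && d)) ((a && d) ^^ (b && c)) := by
  have h0 := hω.mul_self
  have h2 := hω.two_eq_zero
  cases a <;> cases b <;> cases c <;> cases d <;> simp [ofBits, pow_two] <;> grind

theorem unpack_padd (hω : IsGenerator ω) (n : ℕ) (r t : ℕ × ℕ) :
    unpack ω n (padd r t) = unpack ω n r + unpack ω n t := by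
  funext i
  simp [unpack, padd, ofBits_xor hω]

theorem unpack_pmul (hω : IsGenerator ω) (n : ℕ) (r : ℕ × ℕ) :
    unpack ω n (pmul r) = ω • unpack ω n r := by
  funext i
  simp [unpack, pmul, mul_ofBits hω]

theorem unpack_zero (n : ℕ) : unpack ω n (0, 0) = 0 := by
  funext i
  simp [unpack, ofBits]

theorem unpack_psmul (hω : IsGenerator ω) (n : ℕ) (a b : Bool) (r : ℕ × ℕ) :
    unpack ω n (psmul a b r) = ofBits ω a b • unpack ω n r := by
  cases a <;> cases b <;>
    simp [psmul, ofBits, unpack_zero, unpack_pmul hω, smul_smul, hω.mul_self, add_comm]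

/-- The combination of the rows in the list whose coefficients are the entries of `x` at the
given positions. -/
def combine (ω : F) {n : ℕ} (L : List (Fin n × ℕ × ℕ)) : (Fin n → F) →ₗ[F] (Fin n → F) :=
  (L.map fun p => (LinearMap.proj p.1 : (Fin n → F) →ₗ[F] F).smulRight (unpack ω n p.2)).sum

@[simp] theorem combine_nil {n : ℕ} (x : Fin n → F) :
    combine ω ([] : List (Fin n × ℕ × ℕ)) x = 0 := by simp [combine]

@[simp] theorem combine_cons {n : ℕ} (p : Fin n × ℕ × ℕ) (L : List (Fin n × ℕ × ℕ))
    (x : Fin n → F) :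
    combine ω (p :: L) x = x p.1 • unpack ω n p.2 + combine ω L x := by simp [combine]

theorem unpack_recombine (hω : IsGenerator ω) {n : ℕ} (x : ℕ × ℕ) (L : List (Fin n × ℕ × ℕ)) :
    unpack ω n (recombine x L) = combine ω L (unpack ω n x) := by
  induction L with
  | nil => simp [recombine, unpack_zero]
  | cons p L ih =>
    rw [recombine, unpack_padd hω, unpack_psmul hω, ih, combine_cons]
    rfl

theorem combine_mem_span {n : ℕ} (L : List (Fin n × ℕ × ℕ)) (x : Fin n → F) :
    combine ω L x ∈ Submodule.span F {v | ∃ p ∈ L, unpack ω n p.2 = v} := by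
  induction L with
  | nil => simp
  | cons p L ih =>
    rw [combine_cons]
    refine Submodule.add_mem _ (Submodule.smul_mem _ _ (Submodule.subset_span ⟨p, by simp, rfl⟩))
      (Submodule.span_mono ?_ ih)
    rintro v ⟨q, hq, rfl⟩
    exact ⟨q, List.mem_cons_of_mem _ hq, rfl⟩

/-- The step `(z + 1) &&& z` clears the lowest one of `z + 1`, so surviving `d` steps without
reaching zero exhibits `d` ones. The induction needs only that the new mask is a strictly smaller
submask. -/
theorem le_card_of_weightGE {n : ℕ} (d y : ℕ) (hy : y < 2 ^ n) (h : weightGE d y = true) :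
    d ≤ (Finset.univ.filter fun i : Fin n => y.testBit i = true).card := by
  induction d generalizing y with
  | zero => exact Nat.zero_le _
  | succ d ih =>
    cases y with
    | zero => simp [weightGE] at h
    | succ y =>
      rw [weightGE] at h
      have hlt : (y + 1) &&& y < y + 1 := Nat.lt_succ_of_le Nat.and_le_right
      have h1 := ih _ (hlt.trans hy) h
      refine lt_of_le_of_lt h1 (Finset.card_lt_card ?_)
      refine Finset.ssubset_iff_subset_ne.mpr ⟨fun i => ?_, fun heq => hlt.ne ?_⟩
      · simp only [Finset.mem_filter, Finset.mem_univ, true_and, Nat.testBit_and,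
          Bool.and_eq_true]
        exact fun hi => hi.1
      · apply Nat.eq_of_testBit_eq
        intro i
        by_cases hi : i < n
        · have := Finset.ext_iff.mp heq ⟨i, hi⟩
          simp only [Finset.mem_filter, Finset.mem_univ, true_and] at this
          exact Bool.eq_iff_iff.mpr this
        · have hle : 2 ^ n ≤ 2 ^ i := Nat.pow_le_pow_right (by norm_num) (not_lt.mp hi)
          rw [Nat.testBit_lt_two_pow (hlt.trans (hy.trans_le hle)),
            Nat.testBit_lt_two_pow (hy.trans_le hle)]

theorem hammingNorm_unpack [DecidableEq F] (hω : IsGenerator ω) (n : ℕ) (r : ℕ × ℕ) :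
    hammingNorm (unpack ω n r) =
      (Finset.univ.filter fun i : Fin n => (r.1 ||| r.2).testBit i = true).card := by
  unfold hammingNorm
  congr 1
  ext i
  simp only [unpack, ne_eq, ofBits_eq_zero_iff hω, Nat.testBit_or, Bool.not_eq_false]

theorem le_hammingNorm_of_weightGE [DecidableEq F] (hω : IsGenerator ω) (n d : ℕ) (r : ℕ × ℕ)
    (h : weightGE d ((r.1 ||| r.2) % 2 ^ n) = true) : d ≤ hammingNorm (unpack ω n r) := by
  rw [hammingNorm_unpack hω]
  refine (le_card_of_weightGE (n := n) d _ (Nat.mod_lt _ (by positivity)) h).trans (le_of_eq ?_)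
  congr 1
  ext i
  simp [Nat.testBit_mod_two_pow]

/-- The number of positions in the list at which `x` is nonzero. -/
def support [DecidableEq F] {n : ℕ} (L : List (Fin n × ℕ × ℕ)) (x : Fin n → F) : ℕ :=
  L.countP fun p => decide (x p.1 ≠ 0)

theorem combine_eq_zero_of_support [DecidableEq F] {n : ℕ} (L : List (Fin n × ℕ × ℕ))
    (x : Fin n → F) (h : support L x = 0) : combine ω L x = 0 := by
  induction L with
  | nil => simp
  | cons p L ih =>
    simp only [support, List.countP_eq_zero, List.mem_cons, forall_eq_or_imp] at h ih
    rw [combine_cons, ih h.2]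
    simpa using Or.inl h.1

/-- The search branches on the coefficient of the next row: zero costs nothing, each of the values
`1`, `ω`, `ω + 1 = ω * ω` uses one unit of `w`. Once `w` is spent, all remaining coefficients
vanish. -/
theorem le_hammingNorm_of_sumsGE [DecidableEq F] (hω : IsGenerator ω) (n d : ℕ)
    (L : List (Fin n × ℕ × ℕ)) (w : ℕ) (r : ℕ × ℕ) (h : sumsGE n d L w r = true)
    (x : Fin n → F) (hx : support L x ≤ w) :
    d ≤ hammingNorm (unpack ω n r + combine ω L x) := by
  induction L generalizing w r with
  | nil =>
    rw [combine_nil, add_zero]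
    exact le_hammingNorm_of_weightGE hω n d r h
  | cons p L ih =>
    cases w with
    | zero =>
      rw [combine_eq_zero_of_support _ _ (Nat.le_zero.mp hx), add_zero]
      exact le_hammingNorm_of_weightGE hω n d r h
    | succ w =>
      simp only [sumsGE, Bool.and_eq_true] at h
      rw [combine_cons, ← add_assoc]
      by_cases h0 : x p.1 = 0
      · rw [h0, zero_smul, add_zero]
        exact ih _ _ h.1 (by simpa [support, h0] using hx)
      · have hx' : support L x ≤ w := by
          simpa [support, List.countP_cons, h0] using hx
        rcases hω.cases (x p.1) with h1 | h1 | h1 | h1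
        · exact absurd h1 h0
        · rw [h1, one_smul, ← unpack_padd hω]
          exact ih _ _ h.2.1 hx'
        · rw [h1, ← unpack_pmul hω, ← unpack_padd hω]
          exact ih _ _ h.2.2.1 hx'
        · rw [h1, ← hω.mul_self, mul_smul, ← unpack_pmul hω, ← unpack_pmul hω, ← unpack_padd hω]
          exact ih _ _ h.2.2.2 hx'

theorem hammingNorm_const_smul [DecidableEq F] {ι : Type*} [Fintype ι] {c : F} (hc : c ≠ 0)
    (x : ι → F) : hammingNorm (c • x) = hammingNorm x :=
  hammingNorm_smul (fun _ => IsSMulRegular.of_ne_zero hc) x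

/-- Weight is invariant under nonzero scalars, so the first nonzero coefficient may be normalized to
`1`; this cuts the enumeration by a factor of three. -/
theorem le_hammingNorm_of_combosGE [DecidableEq F] (hω : IsGenerator ω) (n d : ℕ)
    (L : List (Fin n × ℕ × ℕ)) (w : ℕ) (h : combosGE n d L w = true)
    (x : Fin n → F) (hx : support L x ≤ w) (hx0 : support L x ≠ 0) :
    d ≤ hammingNorm (combine ω L x) := by
  induction L generalizing w with
  | nil => simp [support] at hx0
  | cons p L ih =>
    cases w with
    | zero => exact absurd (Nat.le_zero.mp hx) hx0
    | succ w =>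
      simp only [combosGE, Bool.and_eq_true] at h
      rw [combine_cons]
      by_cases h0 : x p.1 = 0
      · rw [h0, zero_smul, zero_add]
        refine ih _ h.1 (by simpa [support, h0] using hx) (by simpa [support, h0] using hx0)
      · have hx' : support L ((x p.1)⁻¹ • x) ≤ w := by
          simpa [support, List.countP_cons, h0] using hx
        have := le_hammingNorm_of_sumsGE hω n d L w p.2 h.2 _ hx'
        rw [← hammingNorm_const_smul h0, smul_add, ← map_smul, smul_smul, mul_inv_cancel₀ h0,
          one_smul] at this
        exact this

/-- In characteristic two a sum of bits is a parity. Each fold in `parity` adds the upper half of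
the index range onto the lower half. -/
theorem sum_ofBits (hω : IsGenerator ω) (j y z : ℕ) :
    ∑ i ∈ Finset.range (2 ^ j), ofBits ω (y.testBit i) (z.testBit i) =
      ofBits ω (parity j y) (parity j z) := by
  induction j generalizing y z with
  | zero => simp [parity]
  | succ j ih =>
    rw [parity, parity, ← ih, pow_succ, mul_two, Finset.sum_range_add, ← Finset.sum_add_distrib]
    refine Finset.sum_congr rfl fun i _ => ?_
    rw [Nat.testBit_xor, Nat.testBit_xor, ofBits_xor hω, Nat.testBit_shiftRight,
      Nat.testBit_shiftRight]

/-- The bound on `n` comes from the five folds, which cover `2 ^ 5` bits; reduction modulo `2 ^ n`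
makes the positions beyond `n` contribute zero. -/
theorem hermInner_unpack (hω : IsGenerator ω) {n : ℕ} (hn : n ≤ 32) (r t : ℕ × ℕ) :
    hermInner 2 (unpack ω n r) (unpack ω n t) =
      ofBits ω (pherm n r t).1 (pherm n r t).2 := by
  rw [pherm, ← sum_ofBits hω, hermInner]
  have hsub : Finset.range n ⊆ Finset.range (2 ^ 5) := Finset.range_subset_range.mpr hn
  rw [← Finset.sum_subset hsub, ← Fin.sum_univ_eq_sum_range (fun i => ofBits ω
    (Nat.testBit (((r.1 &&& (t.1 ^^^ t.2)) ^^^ (r.2 &&& t.2)) % 2 ^ n) i)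
    (Nat.testBit (((r.1 &&& t.2) ^^^ (r.2 &&& t.1)) % 2 ^ n) i)) n]
  · refine Finset.sum_congr rfl fun i _ => ?_
    simp only [unpack, ofBits_herm hω, Nat.testBit_mod_two_pow, Nat.testBit_xor, Nat.testBit_and,
      i.2, decide_true, Bool.true_and]
  · intro i _ hi
    have hi : ¬ i < n := by simpa using hi
    simp [Nat.testBit_mod_two_pow, hi, ofBits]

/-! ### From a finite certificate to a Hermitian LCD code -/

/-- Data certifying a Hermitian LCD code of length `n`. Every member of `bases` is an
information set together with the rows of the generator matrix that is systematic on it, so that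
a code word is recovered from its entries there. No position lies in more than `multiplicity`
information sets, up to `excess` exceptions, and the combinations of at most `bound` rows are the
ones whose weight is checked. The words in `dual` form the basis of the code that is dual to the
rows of the first generator matrix, and `word` is a code word of minimum weight. -/
structure Certificate (n : ℕ) where
  bases : List (List (Fin n × ℕ × ℕ))
  dual : List (ℕ × ℕ)
  word : ℕ × ℕ
  bound : ℕ
  multiplicity : ℕ
  excess : ℕ

namespace Certificate

variable {n : ℕ} (c : Certificate n)

/-- The rows of the first generator matrix. -/
def rows : List (ℕ × ℕ) := (c.bases.headD []).map Prod.snd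

/-- The code spanned by the rows of the first generator matrix. -/
def code (ω : F) : Submodule F (Fin n → F) :=
  Submodule.span F {v | ∃ r ∈ c.rows, unpack ω n r = v}

/-- The number of information sets that contain the position `i`. -/
def mult (i : Fin n) : ℕ := (c.bases.map fun L => L.countP fun p => decide (p.1 = i)).sum

/-- All the information sets recover the code. -/
def basesValid : Bool := c.bases.all fun L => c.rows.all fun r => recombine r L == r

/-- A word of weight less than `d` meets some information set in at most `bound` positions. -/
def countValid (d : ℕ) : Bool :=
  decide (c.multiplicity * (d - 1) + c.excess < c.bases.length * (c.bound + 1)) &&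
    decide (∑ i, (c.mult i - c.multiplicity) ≤ c.excess)

/-- The combinations of few rows have weight at least `d`. -/
def weightValid (d : ℕ) : Bool := c.bases.all fun L => combosGE n d L c.bound

/-- `dual` consists of code words and is dual to the rows. -/
def dualValid (k : ℕ) : Bool :=
  c.rows.length == k && c.dual.length == k &&
    (c.dual.all fun t => recombine t (c.bases.headD []) == t) &&
    decide (∀ i < k, ∀ j < k, pherm n (c.rows.getD i 0) (c.dual.getD j 0) = (decide (i = j), false))

/-- `word` is a code word of weight `d`. -/
def wordValid (d : ℕ) : Bool :=
  recombine c.word (c.bases.headD []) == c.word &&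
    decide ((Finset.univ.filter fun i : Fin n => (c.word.1 ||| c.word.2).testBit i = true).card = d)

/-- The certificate proves that there is a Hermitian LCD `[n, k, d]` code. -/
def Valid (k d : ℕ) : Prop :=
  n ≤ 32 ∧ 0 < d ∧ c.basesValid = true ∧ c.countValid d = true ∧ c.weightValid d = true ∧
    c.dualValid k = true ∧ c.wordValid d = true

instance (k d : ℕ) : Decidable (c.Valid k d) := by unfold Valid; infer_instance

variable {c}

theorem combine_head_mem (x : Fin n → F) : combine ω (c.bases.headD []) x ∈ c.code ω := by
  refine Submodule.span_mono ?_ (combine_mem_span _ x)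
  rintro v ⟨p, hp, rfl⟩
  exact ⟨p.2, List.mem_map_of_mem hp, rfl⟩

theorem unpack_mem_code (hω : IsGenerator ω) {r : ℕ × ℕ}
    (h : recombine r (c.bases.headD []) = r) : unpack ω n r ∈ c.code ω := by
  rw [← h, unpack_recombine hω]
  exact combine_head_mem _

/-- Recombination is linear, so it fixes the code once it fixes the generators. The rows attached to
further information sets need not be shown to lie in the code. -/
theorem combine_eq_self (hω : IsGenerator ω) (h : c.basesValid = true)
    {L : List (Fin n × ℕ × ℕ)} (hL : L ∈ c.bases) {x : Fin n → F} (hx : x ∈ c.code ω) :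
    combine ω L x = x := by
  simp only [basesValid, List.all_eq_true, beq_iff_eq] at h
  refine LinearMap.eqOn_span (f := combine ω L) (g := LinearMap.id) ?_ hx
  rintro v ⟨r, hr, rfl⟩
  rw [← unpack_recombine hω, h L hL r hr]
  rfl

theorem support_eq_sum [DecidableEq F] (L : List (Fin n × ℕ × ℕ)) (x : Fin n → F) :
    support L x = ∑ i, if x i ≠ 0 then L.countP (fun p => decide (p.1 = i)) else 0 := by
  induction L with
  | nil => simp [support]
  | cons p L ih =>
    simp only [support] at ih
    simp only [support, List.countP_cons, ih, decide_eq_true_eq]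
    have : (if x p.1 ≠ 0 then 1 else 0) =
        ∑ i, if x i ≠ 0 then (if p.1 = i then 1 else 0) else 0 := by
      rw [Finset.sum_eq_single p.1] <;> simp +contextual [eq_comm]
    rw [this, ← Finset.sum_add_distrib]
    refine Finset.sum_congr rfl fun i _ => ?_
    split_ifs <;> simp

/-- Double counting of pairs (information set, nonzero position in it). The truncated difference
charges only positions covered more than `multiplicity` times. -/
theorem sum_support_le [DecidableEq F] (c : Certificate n) (x : Fin n → F) :
    (c.bases.map fun L => support L x).sum ≤
      c.multiplicity * hammingNorm x + ∑ i, (c.mult i - c.multiplicity) := by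
  have h1 : (c.bases.map fun L => support L x).sum = ∑ i, if x i ≠ 0 then c.mult i else 0 := by
    unfold mult
    induction c.bases with
    | nil => simp
    | cons L B ih =>
      rw [List.map_cons, List.sum_cons, ih, support_eq_sum, ← Finset.sum_add_distrib]
      refine Finset.sum_congr rfl fun i _ => ?_
      split_ifs <;> simp
  have h2 : c.multiplicity * hammingNorm x = ∑ i, if x i ≠ 0 then c.multiplicity else 0 := by
    rw [← Finset.sum_filter, Finset.sum_const, smul_eq_mul, mul_comm]
    rfl
  rw [h1, h2, ← Finset.sum_add_distrib]
  refine Finset.sum_le_sum fun i _ => ?_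
  split_ifs <;> omega

/-- Pigeonhole: if a word of weight at most `d - 1` met every information set in at least `bound +
1` positions, the incidence count would contradict `countValid`. So it is a combination of at most
`bound` rows of one matrix, a case covered by `weightValid`. -/
theorem le_hammingNorm [DecidableEq F] (hω : IsGenerator ω) {k d : ℕ} (h : c.Valid k d)
    {x : Fin n → F} (hx : x ∈ c.code ω) (hx0 : x ≠ 0) : d ≤ hammingNorm x := by
  obtain ⟨-, hd, hb, hc, hw, -, -⟩ := h
  simp only [countValid, Bool.and_eq_true, decide_eq_true_eq] at hc
  by_contra! hlt
  obtain ⟨L, hL, hLx⟩ : ∃ L ∈ c.bases, support L x ≤ c.bound := by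
    by_contra! hall
    have h1 : c.bases.length * (c.bound + 1) ≤ (c.bases.map fun L => support L x).sum := by
      have := List.card_nsmul_le_sum (c.bases.map fun L => support L x) (c.bound + 1) (by
        simp only [List.mem_map, forall_exists_index, and_imp, forall_apply_eq_imp_iff₂]
        exact fun L hL => hall L hL)
      simpa using this
    have h2 := c.sum_support_le x
    have h3 : c.multiplicity * hammingNorm x ≤ c.multiplicity * (d - 1) :=
      Nat.mul_le_mul_left _ (by omega)
    omega
  have hself := combine_eq_self hω hb hL hx
  -- A word vanishing on the whole information set is recovered as zero.
  have h0 : support L x ≠ 0 := fun h0 => hx0 (by rw [← hself, combine_eq_zero_of_support L x h0])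
  simp only [weightValid, List.all_eq_true] at hw
  have := le_hammingNorm_of_combosGE hω n d L _ (hw L hL) x hLx h0
  rw [hself] at this
  omega

theorem hermInner_sum_left {ι : Type*} (s : Finset ι) (f : ι → F) (v : ι → Fin n → F)
    (y : Fin n → F) :
    hermInner 2 (∑ i ∈ s, f i • v i) y = ∑ i ∈ s, f i * hermInner 2 (v i) y := by
  simp only [hermInner, Finset.sum_apply, Pi.smul_apply, smul_eq_mul, Finset.sum_mul,
    Finset.mul_sum, mul_assoc]
  exact Finset.sum_comm

/-- Pairing with `b j` reads off the coefficient of `g j`. This gives linear independence of the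
rows, hence the dimension; and since each `b j` is itself a codeword, a codeword in the Hermitian
dual has all coefficients zero. -/
theorem exists_code [DecidableEq F] (hω : IsGenerator ω) {k d : ℕ} (h : c.Valid k d) :
    ∃ C : Submodule F (Fin n → F), IsCode n k d C ∧ IsHermitianLCD 2 C := by
  have hle := fun x hx hx0 => le_hammingNorm (x := x) hω h hx hx0
  obtain ⟨hn, hd, hb, -, -, hdual, hword⟩ := h
  simp only [dualValid, Bool.and_eq_true, beq_iff_eq, decide_eq_true_eq, List.all_eq_true] at hdual
  obtain ⟨⟨⟨hrl, hdl⟩, hdmem⟩, hdual⟩ := hdual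
  set g : Fin k → Fin n → F := fun i => unpack ω n (c.rows.getD i 0) with hg
  set b : Fin k → Fin n → F := fun i => unpack ω n (c.dual.getD i 0) with hbd
  have hgb : ∀ i j, hermInner 2 (g i) (b j) = if i = j then 1 else 0 := fun i j => by
    rw [hg, hbd, hermInner_unpack hω hn, hdual i i.2 j j.2]
    simp [ofBits, Fin.ext_iff]
  have hcoef : ∀ (f : Fin k → F) (j : Fin k), hermInner 2 (∑ i, f i • g i) (b j) = f j := by
    intro f j
    rw [hermInner_sum_left]
    simp [hgb]
  have hspan : c.code ω = Submodule.span F (Set.range g) := by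
    unfold code
    congr 1
    ext v
    constructor
    · rintro ⟨r, hr, rfl⟩
      obtain ⟨i, hi, rfl⟩ := List.mem_iff_getElem.mp hr
      exact ⟨⟨i, by omega⟩, by simp [hg, hi]⟩
    · rintro ⟨i, rfl⟩
      have hi : (i : ℕ) < c.rows.length := by omega
      exact ⟨c.rows[(i : ℕ)], List.getElem_mem hi, by simp [hg, hi]⟩
  have hli : LinearIndependent F g := by
    rw [Fintype.linearIndependent_iff]
    intro f hf i
    rw [← hcoef f i, hf]
    simp [hermInner]
  refine ⟨c.code ω, ⟨?_, ?_⟩, ?_⟩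
  · rw [hspan, finrank_span_eq_card hli, Fintype.card_fin]
  · simp only [wordValid, Bool.and_eq_true, beq_iff_eq, decide_eq_true_eq] at hword
    have hw : hammingNorm (unpack ω n c.word) = d := by rw [hammingNorm_unpack hω, hword.2]
    refine ⟨⟨_, unpack_mem_code hω hword.1, ?_, hw⟩, ?_⟩
    · rw [← hammingNorm_pos_iff, hw]
      exact hd
    · rintro _ ⟨x, hx, hx0, rfl⟩
      exact hle x hx hx0
  · rw [IsHermitianLCD, eq_bot_iff]
    rintro x ⟨hx, hx'⟩
    rw [hspan, SetLike.mem_coe, Submodule.mem_span_range_iff_exists_fun] at hx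
    obtain ⟨f, rfl⟩ := hx
    rw [Submodule.mem_bot]
    refine Finset.sum_eq_zero fun i _ => ?_
    have hi : (i : ℕ) < c.dual.length := by omega
    have : b i ∈ c.code ω := unpack_mem_code hω (hdmem _ (by simp [hi]))
    rw [← hcoef f i, hx' _ this, zero_smul]

end Certificate

end Packed

/-! ### Counting points off a hyperplane in projective space -/

open Projectivization in
-- A nonzero vector is a unique unit multiple of the representative of its line, and nonvanishing of
-- `φ` depends only on the line.
theorem card_nonvanishing_eq_mul {K V : Type*} [Field K] [AddCommGroup V] [Module K V]
    (φ : V →ₗ[K] K) :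
    Nat.card {v : V // φ v ≠ 0} = Nat.card {p : Projectivization K V // φ p.rep ≠ 0} * Nat.card Kˣ := by
  rw [← Nat.card_prod]
  symm
  refine Nat.card_congr (Equiv.ofBijective (fun q => ⟨q.2 • q.1.1.rep, ?_⟩) ⟨?_, ?_⟩)
  · rw [Units.smul_def, map_smul]
    exact smul_ne_zero q.2.ne_zero q.1.2
  · rintro ⟨⟨p, hp⟩, a⟩ ⟨⟨q, hq⟩, b⟩ h
    have h : a • p.rep = b • q.rep := congrArg Subtype.val h
    have hpq : p = q := by
      rw [← mk_rep p, ← mk_rep q, mk_eq_mk_iff]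
      exact ⟨a⁻¹ * b, by rw [mul_smul, ← h, inv_smul_smul]⟩
    subst hpq
    have hab : a = b := by
      refine Units.ext (smul_left_injective K p.rep_nonzero ?_)
      simpa [Units.smul_def] using h
    rw [hab]
  · rintro ⟨v, hv⟩
    have hv0 : v ≠ 0 := fun h => hv (by rw [h, map_zero])
    obtain ⟨a, ha⟩ := exists_smul_eq_mk_rep K v hv0
    refine ⟨⟨⟨mk K v hv0, ?_⟩, a⁻¹⟩, ?_⟩
    · rw [← ha, Units.smul_def, map_smul]
      exact smul_ne_zero a.ne_zero hv
    · simp [← ha]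

/-- A nonzero linear form is nonzero at exactly `q ^ (k - 1)` points of the projective space of a
`k`-dimensional vector space over a field of order `q`. -/
theorem card_nonvanishing_points {K V : Type*} [Field K] [Fintype K] [AddCommGroup V] [Module K V]
    [FiniteDimensional K V] {φ : V →ₗ[K] K} (hφ : φ ≠ 0) :
    Nat.card {p : Projectivization K V // φ p.rep ≠ 0} =
      Fintype.card K ^ (Module.finrank K V - 1) := by
  classical
  have hq : 1 < Fintype.card K := Fintype.one_lt_card
  have : Finite V := Module.finite_of_finite K
  have hker : Module.finrank K (LinearMap.ker φ) + 1 = Module.finrank K V :=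
    Module.Dual.finrank_ker_add_one_of_ne_zero hφ
  have h1 : Nat.card (LinearMap.ker φ) + Nat.card {v : V // φ v ≠ 0} = Nat.card V := by
    rw [← Nat.card_sum]
    exact Nat.card_congr (Equiv.sumCompl fun v => φ v = 0)
  rw [card_nonvanishing_eq_mul, Module.natCard_eq_pow_finrank (K := K) (V := V),
    Module.natCard_eq_pow_finrank (K := K) (V := LinearMap.ker φ), ← hker, Nat.card_units,
    Nat.card_eq_fintype_card, pow_succ] at h1
  rw [← hker, Nat.add_sub_cancel]
  -- Writing the field order as `m + 2` removes truncated subtraction; the count then follows by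
  -- cancelling the number `m + 1` of units.
  obtain ⟨m, hm⟩ : ∃ m, Fintype.card K = m + 2 := ⟨_, (Nat.sub_add_cancel hq).symm⟩
  rw [hm] at h1 ⊢
  have h2 : m + 2 - 1 = m + 1 := rfl
  rw [h2] at h1
  refine Nat.eq_of_mul_eq_mul_right (Nat.succ_pos m) ?_
  linarith

theorem card_points {K V : Type*} [Field K] [Fintype K] [AddCommGroup V] [Module K V]
    [FiniteDimensional K V] :
    Nat.card (Projectivization K V) =
      (Fintype.card K ^ Module.finrank K V - 1) / (Fintype.card K - 1) := by
  rw [Projectivization.card'', Module.natCard_eq_pow_finrank (K := K), Nat.card_eq_fintype_card]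

/-! ### Extension by simplex codes -/

section Simplex

variable {F : Type*} [Field F] {ω : F}

/-- If `∑ f³` vanishes on a family of functions closed under linear combinations, then so does
the Hermitian product `∑ f g²`. -/
theorem sum_mul_sq_eq_zero (hω : IsGenerator ω) {ι : Type*} (s : Finset ι) (f g : ι → F)
    (h : ∀ a b : F, ∑ i ∈ s, (a * f i + b * g i) ^ 3 = 0) : ∑ i ∈ s, f i * g i ^ 2 = 0 := by
  have expand : ∀ a b : F, ∑ i ∈ s, (a * f i + b * g i) ^ 3 =
      a ^ 3 * ∑ i ∈ s, f i ^ 3 + 3 * a ^ 2 * b * ∑ i ∈ s, f i ^ 2 * g i +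
        3 * a * b ^ 2 * ∑ i ∈ s, f i * g i ^ 2 + b ^ 3 * ∑ i ∈ s, g i ^ 3 := fun a b => by
    simp only [Finset.mul_sum, ← Finset.sum_add_distrib]
    exact Finset.sum_congr rfl fun i _ => by ring
  -- The pairs `(1, 0)` and `(0, 1)` kill the pure cubes. As `3 = 1`, the pairs `(1, 1)` and `(1,
  -- ω)` then give `B + C = 0` and `ω B + ω ^ 2 C = 0`, and `ω + ω ^ 2 = 1` forces `C = 0`.
  have h10 := h 1 0
  have h01 := h 0 1
  have h11 := h 1 1
  have h1ω := h 1 ω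
  rw [expand] at h10 h01 h11 h1ω
  have h2 := hω.two_eq_zero
  have hωω := hω.mul_self
  generalize ∑ i ∈ s, f i ^ 3 = A at *
  generalize ∑ i ∈ s, f i ^ 2 * g i = B at *
  generalize ∑ i ∈ s, f i * g i ^ 2 = C at *
  generalize ∑ i ∈ s, g i ^ 3 = D at *
  grind

theorem natCard_units_pow_three (hF : Nat.card F = 4) {x : F} (hx : x ≠ 0) : x ^ 3 = 1 := by
  have : Finite F := Nat.finite_of_card_ne_zero (by omega)
  have := Fintype.ofFinite F
  have h := FiniteField.pow_card_sub_one_eq_one x hx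
  rwa [← Nat.card_eq_fintype_card, hF] at h

/-- A Hermitian LCD `[n, k, d]` code over the field of four elements can be extended by `s` copies
of the simplex code, which is Hermitian self-orthogonal and of constant weight. -/
theorem exists_simplex_extension [Fintype F] [DecidableEq F] (hF : Fintype.card F = 4)
    (hω : IsGenerator ω) {n k d : ℕ} (hk : 2 ≤ k)
    {C : Submodule F (Fin n → F)} (hC : IsCode n k d C) (hL : IsHermitianLCD 2 C) (s : ℕ) :
    ∃ C' : Submodule F (Fin (n + (4 ^ k - 1) / 3 * s) → F),
      IsCode (n + (4 ^ k - 1) / 3 * s) k (d + 4 ^ (k - 1) * s) C' ∧ IsHermitianLCD 2 C' := by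
  classical
  obtain ⟨hdim, ⟨x₀, hx₀C, hx₀, hx₀d⟩, hmin⟩ := hC
  have hdual : Module.finrank F (Module.Dual F C) = k := by rw [Subspace.dual_finrank_eq, hdim]
  have : Finite (Module.Dual F C) := Module.finite_of_finite F
  have := Fintype.ofFinite (Projectivization F (Module.Dual F C))
  set P := Projectivization F (Module.Dual F C)
  have hcard : Fintype.card P = (4 ^ k - 1) / 3 := by
    rw [← Nat.card_eq_fintype_card, card_points, hF, hdual]
  let e : Fin (n + (4 ^ k - 1) / 3 * s) ≃ Fin n ⊕ P × Fin s := Fintype.equivOfCardEq (by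
    simp [hcard])
  -- The simplex code without coordinates: the entry of `x` at a point is the value at `x` of the
  -- functional representing that point.
  let S : C →ₗ[F] (P → F) := LinearMap.pi fun p => p.rep
  have hSweight : ∀ x : C, x ≠ 0 → hammingNorm (S x) = 4 ^ (k - 1) := fun x hx => by
    have hev : Module.Dual.eval F C x ≠ 0 := fun h0 => hx ((Module.eval_apply_eq_zero_iff F x).mp h0)
    have h1 := card_nonvanishing_points hev
    rw [hF, hdual, Nat.card_eq_fintype_card, Fintype.card_subtype] at h1
    exact h1
  have hcube : ∀ x : C, ∑ p, S x p ^ 3 = 0 := fun x => by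
    by_cases hx : x = 0
    · simp [hx]
    · have h1 : ∑ p, S x p ^ 3 = (hammingNorm (S x) : F) := by
        rw [hammingNorm, Finset.card_filter, Nat.cast_sum]
        refine Finset.sum_congr rfl fun p _ => ?_
        by_cases h0 : S x p = 0
        · simp [h0]
        · simp [h0, natCard_units_pow_three (by rw [Nat.card_eq_fintype_card, hF]) h0]
      have h4 : (4 : F) = 0 := by linear_combination 2 * hω.two_eq_zero
      -- This is where `2 ≤ k` is needed: the weight `4 ^ (k - 1)` must vanish in `F`.
      rw [h1, hSweight x hx, Nat.cast_pow, Nat.cast_ofNat, h4, zero_pow (by omega)]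
  have hSherm : ∀ x y : C, ∑ p, S x p * S y p ^ 2 = 0 := fun x y =>
    sum_mul_sq_eq_zero hω _ _ _ fun a b => by
      rw [← hcube (a • x + b • y)]
      simp only [map_add, map_smul, Pi.add_apply, Pi.smul_apply, smul_eq_mul]
  let T : C →ₗ[F] (Fin (n + (4 ^ k - 1) / 3 * s) → F) :=
    { toFun := fun x i => Sum.elim (x : Fin n → F) (fun q => S x q.1) (e i)
      map_add' := fun x y => by
        funext i
        rcases h : e i with j | q <;> simp [h]
      map_smul' := fun a x => by
        funext i
        rcases h : e i with j | q <;> simp [h] }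
  have hTe : ∀ x i, T x i = Sum.elim (x : Fin n → F) (fun q => S x q.1) (e i) := fun _ _ => rfl
  have hTinj : Function.Injective T := fun x y hxy => by
    ext j
    simpa [hTe] using congrFun hxy (e.symm (Sum.inl j))
  have hTnorm : ∀ x : C, x ≠ 0 → hammingNorm (T x) = hammingNorm (x : Fin n → F) + 4 ^ (k - 1) * s :=
    fun x hx => by
      have h1 : hammingNorm (T x) =
          ∑ i, if Sum.elim (x : Fin n → F) (fun q : P × Fin s => S x q.1) i ≠ 0 then 1 else 0 := by
        rw [hammingNorm, Finset.card_filter]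
        exact Equiv.sum_comp e fun i =>
          if Sum.elim (x : Fin n → F) (fun q : P × Fin s => S x q.1) i ≠ 0 then 1 else 0
      rw [h1, Fintype.sum_sum_type, Fintype.sum_prod_type, ← hSweight x hx, hammingNorm,
        hammingNorm, Finset.card_filter, Finset.card_filter, Finset.sum_mul]
      refine congrArg₂ _ rfl (Finset.sum_congr rfl fun p _ => ?_)
      by_cases h0 : S x p = 0 <;> simp [h0]
  have hTherm : ∀ x y : C, hermInner 2 (T x) (T y) = hermInner 2 (x : Fin n → F) y := fun x y => by
    have h1 : hermInner 2 (T x) (T y) =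
        ∑ i, Sum.elim (x : Fin n → F) (fun q : P × Fin s => S x q.1) i *
          Sum.elim (y : Fin n → F) (fun q : P × Fin s => S y q.1) i ^ 2 :=
      Equiv.sum_comp e fun i => Sum.elim (x : Fin n → F) (fun q : P × Fin s => S x q.1) i *
          Sum.elim (y : Fin n → F) (fun q : P × Fin s => S y q.1) i ^ 2
    rw [h1, Fintype.sum_sum_type, Fintype.sum_prod_type_right]
    simp [hSherm, hermInner]
  refine ⟨LinearMap.range T, ⟨?_, ⟨?_, ?_⟩⟩, ?_⟩
  · rw [LinearMap.finrank_range_of_inj hTinj, hdim]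
  · have hne : (⟨x₀, hx₀C⟩ : C) ≠ 0 := fun h => hx₀ (congrArg Subtype.val h)
    refine ⟨T ⟨x₀, hx₀C⟩, ⟨_, rfl⟩, fun h => hne (hTinj (h.trans (map_zero T).symm)), ?_⟩
    rw [hTnorm _ hne, hx₀d]
  · rintro _ ⟨_, ⟨x, rfl⟩, hx, rfl⟩
    have hne : x ≠ 0 := fun h => hx (by rw [h, map_zero])
    rw [hTnorm x hne]
    exact Nat.add_le_add_right (hmin ⟨x, x.2, fun h => hne (Subtype.ext h), rfl⟩) _
  · rw [IsHermitianLCD, eq_bot_iff]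
    rintro _ ⟨⟨x, rfl⟩, hx⟩
    have h1 : (x : Fin n → F) ∈ C ⊓ hermDual 2 C :=
      ⟨x.2, fun y hy => by rw [← hTherm x ⟨y, hy⟩]; exact hx _ ⟨_, rfl⟩⟩
    rw [hL, Submodule.mem_bot] at h1
    have : x = 0 := Subtype.ext h1
    rw [Submodule.mem_bot, this, map_zero]

end Simplex

/-! ### Explicit certificates for the 21 base codes -/

/-- Certificate for a Hermitian LCD `[21, 8, 9]` code. -/
def certificate_21_8_9 : Certificate 21 where
  bases := [
    List.zip [
      0, 1, 2, 3, 4, 5, 6, 7] [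
      (0xd2b01, 0x66300), (0x55d02, 0x6a200), (0x185404, 0xbd700), (0x34a08, 0x1e9800),
      (0xa9b10, 0x1b2600), (0xe1c20, 0xaf300), (0xc740, 0x158e00), (0x1bfb80, 0x64400)],
    List.zip [
      13, 14, 15, 16, 17, 18, 19, 20] [
      (0x38c2, 0xd0b), (0x5ae7, 0x9a), (0x9c17, 0x16b5), (0x11107, 0x4b2), (0x20ff5, 0x1751),
      (0x401e7, 0x1bea), (0x80209, 0x1c4e), (0x101568, 0x85d)]]
  dual := [
    (0x62da0, 0x441c0), (0x5f4dc, 0x152338), (0x15013a, 0x102b0), (0x1e2a4, 0x7022),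
    (0x1aba0, 0x10d2e6), (0x7a43, 0x95c1e), (0xa4fb3, 0xda511), (0x8164e, 0xf1515)]
  word := (0xb4122, 0xc5100)
  bound := 4
  multiplicity := 1
  excess := 0

theorem valid_21_8_9 : certificate_21_8_9.Valid 8 9 := by decide +kernel

/-- Certificate for a Hermitian LCD `[21, 10, 8]` code. -/
def certificate_21_10_8 : Certificate 21 where
  bases := [
    List.zip [
      0, 1, 2, 3, 4, 5, 6, 7, 8, 9] [
      (0x27001, 0xce000), (0x187802, 0x1c0400), (0x86c04, 0xf2c00), (0x1a9408, 0xfc000),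
      (0xf6410, 0xb1c00), (0x1db420, 0x59400), (0x18840, 0x1e5400), (0x19bc80, 0x1b6400),
      (0x95900, 0xd9c00), (0xcaa00, 0x139c00)],
    List.zip [
      11, 12, 13, 14, 15, 16, 17, 18, 19, 20] [
      (0xda7, 0x3a7), (0x163d, 0x703), (0x21cb, 0x1ee), (0x43fc, 0x17c), (0x86d2, 0x7d6),
      (0x10498, 0x17f), (0x200dc, 0x751), (0x40492, 0x388), (0x80460, 0x1b), (0x10034c, 0x510)]]
  dual := [
    (0x10115a, 0x10b450), (0x70289, 0x388c8), (0x9982c, 0x1ea50), (0xb96f5, 0x186862),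
    (0x139f6c, 0xe2485), (0x2b234, 0x5b488), (0x3d216, 0x13500f), (0xd9138, 0xf0332),
    (0x94611, 0x98e80), (0x19b0fe, 0x160d84)]
  word := (0x27001, 0xce000)
  bound := 3
  multiplicity := 1
  excess := 0

theorem valid_21_10_8 : certificate_21_10_8.Valid 10 8 := by decide +kernel

/-- Certificate for a Hermitian LCD `[21, 11, 7]` code. -/
def certificate_21_11_7 : Certificate 21 where
  bases := [
    List.zip [
      0, 1, 2, 3, 4, 5, 6, 7, 8, 9, 10] [
      (0x11b801, 0x168000), (0xae002, 0x15d000), (0xed804, 0x164800), (0x95008, 0xb8800),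
      (0x143010, 0xcc800), (0x13a020, 0xd0000), (0x1c1840, 0x58800), (0x1f4880, 0xbe000),
      (0x136100, 0x173000), (0xd3200, 0x97000), (0x1dfc00, 0x24000)],
    List.zip [
      10, 11, 12, 13, 14, 15, 16, 17, 18, 19, 20] [
      (0x795, 0x264), (0x965, 0x15c), (0x13a3, 0x164), (0x219c, 0x3d3), (0x415d, 0xc3),
      (0x81fb, 0xcd), (0x101af, 0x285), (0x2039e, 0x2a2), (0x4038e, 0x235), (0x8003b, 0x2d4),
      (0x100012, 0x347)]]
  dual := [
    (0xfc229, 0xf978a), (0x128397, 0x1d439d), (0x1ecf78, 0x553fa), (0x1c265a, 0xe27c7),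
    (0x10bdf8, 0x1bd3c6), (0x83551, 0x166204), (0x1df8e0, 0x1e771c), (0x13acd, 0xd1e1f),
    (0x1b7e69, 0x6665f), (0x12fa70, 0x1ffdff), (0x1bb2f5, 0xed3c9)]
  word := (0xd3200, 0x97000)
  bound := 3
  multiplicity := 1
  -- Two information sets of size 11 in 21 positions must overlap; here they share only position 10.
  -- The count is `6 + 1 < 2 * 4`.
  excess := 1

theorem valid_21_11_7 : certificate_21_11_7.Valid 11 7 := by decide +kernel

/-- Certificate for a Hermitian LCD `[22, 8, 10]` code. -/
def certificate_22_8_10 : Certificate 22 where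
  bases := [
    List.zip [
      0, 1, 2, 3, 4, 5, 6, 7] [
      (0xac601, 0x3d1d00), (0x5be02, 0x267100), (0x3ff504, 0x11da00), (0x2c7808, 0x34d800),
      (0x300910, 0x2f9e00), (0xa7c20, 0x254b00), (0x153540, 0x398500), (0x320e80, 0xccb00)],
    List.zip [
      14, 15, 16, 17, 18, 19, 20, 21] [
      (0x7f6d, 0x2f87), (0x9259, 0x539), (0x137b3, 0x34ab), (0x2059e, 0x224b), (0x434c1, 0x198c),
      (0x83f1a, 0x3b1f), (0x103b36, 0x3ce0), (0x203805, 0x3b69)]]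
  dual := [
    (0x19b740, 0x1ef8ac), (0x3696f6, 0x3fa728), (0x152637, 0x1c3f59), (0x237a5f, 0x2f0ce7),
    (0xa128a, 0x304d04), (0x2f014d, 0x13eb8b), (0x133827, 0x27b78c), (0x2b45fb, 0x3cd369)]
  word := (0x2c7808, 0x34d800)
  bound := 4
  multiplicity := 1
  excess := 0

theorem valid_22_8_10 : certificate_22_8_10.Valid 8 10 := by decide +kernel

/-- Certificate for a Hermitian LCD `[23, 18, 4]` code. -/
def certificate_23_18_4 : Certificate 23 where
  bases := [
    List.zip [
      0, 1, 2, 3, 4, 5, 6, 7, 8, 9, 10, 11, 12, 13, 14, 15, 16, 17] [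
      (0x80001, 0x3c0000), (0x40002, 0x780000), (0x300004, 0x40000), (0x680008, 0x740000),
      (0x640010, 0x240000), (0x300020, 0x2c0000), (0x140040, 0x4c0000), (0x640080, 0x480000),
      (0x4c0100, 0x600000), (0x600200, 0x380000), (0x340400, 0x140000), (0x540800, 0x780000),
      (0x81000, 0x600000), (0x142000, 0x640000), (0x684000, 0x780000), (0x688000, 0x500000),
      (0x590000, 0x6c0000), (0x360000, 0x600000)]]
  dual := [
    (0x4b2d51, 0x184e44), (0x341ca6, 0xb4044), (0x6f2a55, 0x520b93), (0x6a7cb0, 0x77c480),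
    (0x6afe59, 0x14c9a4), (0x2c1e3a, 0x280210), (0x69a756, 0x49d283), (0x5d9956, 0x3d4f5c),
    (0x279155, 0x47294), (0x7bc391, 0x53e1e5), (0x3e90f2, 0x5ec089), (0x1c782a, 0xa095),
    (0x5cfa, 0x702140), (0x2ab35d, 0x33db00), (0x2abdc3, 0x3c27db), (0x694988, 0x462e58),
    (0x69a10f, 0x3022ca), (0x34c113, 0x4ca60e)]
  word := (0x300004, 0x40000)
  -- For `d = 4` one information set suffices: a word of weight at most 3 involves at most 3 rows.
  bound := 3
  multiplicity := 1
  excess := 0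

theorem valid_23_18_4 : certificate_23_18_4.Valid 18 4 := by decide +kernel

/-- Certificate for a Hermitian LCD `[24, 16, 6]` code. -/
def certificate_24_16_6 : Certificate 24 where
  bases := [
    List.zip [
      8, 9, 10, 11, 12, 13, 14, 15, 16, 17, 18, 19, 20, 21, 22, 23] [
      (0x1c1, 0xe8), (0x225, 0xe8), (0x4b9, 0xde), (0x8ea, 0x95), (0x10b3, 0xc0), (0x20e6, 0x7c),
      (0x4029, 0x14), (0x8091, 0x35), (0x100a2, 0xe8), (0x20075, 0xdd), (0x400dc, 0x95),
      (0x800dc, 0xfc), (0x100037, 0x5c), (0x2000b6, 0x14), (0x400070, 0x27), (0x800031, 0x7d)],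
    List.zip [
      0, 1, 2, 3, 4, 5, 6, 7, 16, 17, 18, 19, 20, 21, 22, 23] [
      (0xbd01, 0xb400), (0xae02, 0x8500), (0xad04, 0xd000), (0xa708, 0x4600), (0x7a10, 0xe00),
      (0x8420, 0xfb00), (0xfc40, 0xee00), (0xd680, 0xc500), (0x16a00, 0x2400), (0x21500, 0x9f00),
      (0x4f500, 0xa000), (0x81200, 0x2500), (0x103600, 0xee00), (0x20f500, 0x6c00),
      (0x401800, 0x3b00), (0x807a00, 0xcd00)],
    List.zip [
      0, 1, 2, 3, 4, 5, 6, 7, 8, 9, 10, 11, 12, 13, 14, 15] [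
      (0xfe0001, 0xbd0000), (0x310002, 0x3c0000), (0xf70004, 0xdb0000), (0x790008, 0xeb0000),
      (0x7a0010, 0x9c0000), (0x4f0020, 0xeb0000), (0xc40040, 0xb10000), (0x940080, 0x5a0000),
      (0x450100, 0xdb0000), (0xad0200, 0x0), (0x5d0400, 0x950000), (0xf70800, 0x900000),
      (0x851000, 0x170000), (0x2f2000, 0x6e0000), (0x8f4000, 0x770000), (0x18000, 0x560000)]]
  dual := [
    (0x284c20, 0x45cc62), (0x7ba95, 0x9a0884), (0x712802, 0x26148), (0x834419, 0xe34300),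
    (0xccb2b5, 0xc20a1), (0x80a214, 0xc14a1), (0x1b0401, 0xda0d82), (0x99b325, 0x810193),
    (0x104770, 0x508958), (0x24040b, 0x704e29), (0x1e2395, 0x883138), (0x88a3ab, 0x47298),
    (0x6864a, 0x43420e), (0x800dcc, 0x42085e), (0x335d4a, 0x33494a), (0xac7217, 0x4ca22)]
  word := (0x1c1, 0xe8)
  bound := 3
  -- The three information sets cover every position exactly twice, and `2 * 5 < 3 * 4`.
  multiplicity := 2
  excess := 0

theorem valid_24_16_6 : certificate_24_16_6.Valid 16 6 := by decide +kernel

/-- Certificate for a Hermitian LCD `[25, 18, 4]` code. -/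
def certificate_25_18_4 : Certificate 25 where
  bases := [
    List.zip [
      0, 1, 2, 3, 4, 5, 6, 7, 8, 9, 10, 11, 12, 13, 14, 15, 16, 17] [
      (0x12c0001, 0x1300000), (0x1b80002, 0x1f00000), (0x3c0004, 0x1a80000),
      (0x1cc0008, 0x1c80000), (0x1f00010, 0xe80000), (0x1480020, 0xbc0000),
      (0x6c0040, 0x1a00000), (0x1f40080, 0x980000), (0x7c0100, 0x19c0000),
      (0x1600200, 0x12c0000), (0x100400, 0xe40000), (0x19c0800, 0x4c0000), (0x1441000, 0x780000),
      (0x1e02000, 0x1980000), (0xfc4000, 0x580000), (0xa08000, 0x540000), (0x890000, 0x1080000),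
      (0x15a0000, 0x1440000)]]
  dual := [
    (0x198abd4, 0x10c138), (0x1f111aa, 0x10307c4), (0x19de913, 0xfa7fc2), (0x496a2b, 0x1923811),
    (0xf2a11c, 0x1b1ac9), (0x120666b, 0x1a31c1), (0xa157, 0x1cae8b6), (0x1318f75, 0x1df3876),
    (0xb681f0, 0x1123a27), (0x4079bf, 0x917916), (0x3cd4a6, 0x18b8806), (0x808d51, 0xaa67dc),
    (0xf7d5be, 0x1eec3bc), (0x1a991, 0x1878bec), (0x10d4c69, 0x129a45), (0x56c994, 0x19a7441),
    (0xd5561c, 0x8a2692), (0xf76cee, 0xf5fdfe)]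
  word := (0x890000, 0x1080000)
  bound := 3
  multiplicity := 1
  excess := 0

theorem valid_25_18_4 : certificate_25_18_4.Valid 18 4 := by decide +kernel

/-- Certificate for a Hermitian LCD `[25, 19, 4]` code. -/
def certificate_25_19_4 : Certificate 25 where
  bases := [
    List.zip [
      0, 1, 2, 3, 4, 5, 6, 7, 8, 9, 10, 11, 12, 13, 14, 15, 16, 17, 18] [
      (0x1580001, 0xa00000), (0x880002, 0x1f00000), (0x1900004, 0xb80000),
      (0x1500008, 0x1700000), (0x1300010, 0xb80000), (0xe00020, 0x0), (0x180040, 0xf80000),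
      (0x900080, 0x1a80000), (0xb00100, 0x0), (0xe80200, 0x880000), (0xf00400, 0xd00000),
      (0x1780800, 0xe80000), (0x1381000, 0x1600000), (0x1002000, 0x780000),
      (0x1b04000, 0x300000), (0x1c08000, 0x1580000), (0x910000, 0x1100000),
      (0x1aa0000, 0xd00000), (0x1dc0000, 0xe80000)]]
  dual := [
    (0x148a4e8, 0x18c18a), (0x12ea7f9, 0x509175), (0xd0ca56, 0x1c8fd12), (0x1623f92, 0x129e971),
    (0xd2de00, 0x34542e), (0xc405f9, 0x16e81da), (0x17bbe0d, 0xe50c2a), (0x1a9b00a, 0x14b2021),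
    (0x1d65105, 0x196a42f), (0x108e05e, 0x10dd800), (0x18ff12f, 0x166954), (0x772e10, 0x7cb64c),
    (0x1c8efce, 0xae0a16), (0x16e1347, 0x169cd8c), (0x11ab109, 0x100261d), (0x827df8, 0x1892b2f),
    (0x10eae08, 0xa0a2c8), (0x139f8fa, 0x1f015a0), (0x713252, 0x1801f70)]
  word := (0xe00020, 0x0)
  bound := 3
  multiplicity := 1
  excess := 0

theorem valid_25_19_4 : certificate_25_19_4.Valid 19 4 := by decide +kernel

/-- Certificate for a Hermitian LCD `[26, 16, 6]` code. -/
def certificate_26_16_6 : Certificate 26 where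
  bases := [
    List.zip [
      10, 11, 12, 13, 14, 15, 16, 17, 18, 19, 20, 21, 22, 23, 24, 25] [
      (0x5b3, 0x369), (0x8f8, 0x378), (0x1239, 0x3ba), (0x224e, 0x2c5), (0x4003, 0x1bc),
      (0x8294, 0x17a), (0x1008d, 0x34b), (0x20340, 0x239), (0x40101, 0x2c5), (0x8023e, 0x2d9),
      (0x10010b, 0x105), (0x20013c, 0x364), (0x4000e8, 0x310), (0x800191, 0x159),
      (0x10000ef, 0x75), (0x2000107, 0x9b)],
    List.zip [
      0, 1, 2, 3, 4, 5, 6, 7, 8, 9, 20, 21, 22, 23, 24, 25] [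
      (0xecc01, 0xcc800), (0x51002, 0x32000), (0x5f804, 0x98800), (0xe9808, 0xa1800),
      (0x5a410, 0x5e800), (0x7e020, 0xe6400), (0xc1c40, 0x33000), (0xd2480, 0x70800),
      (0x7500, 0x48800), (0x8f600, 0xbc000), (0x14f800, 0xbf000), (0x22c400, 0x18400),
      (0x42e000, 0x7c000), (0x82b800, 0x7b800), (0x10b9800, 0xeb400), (0x2094000, 0x83c00)],
    List.zip [
      0, 1, 2, 3, 4, 5, 6, 7, 8, 9, 10, 11, 12, 13, 14, 15] [
      (0x2240001, 0x3440000), (0x32c0002, 0x1840000), (0x1c0004, 0x3d90000),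
      (0x2660008, 0xe70000), (0x2d00010, 0x2c70000), (0x3180020, 0x2e10000),
      (0x3220040, 0x2a30000), (0x500080, 0x3760000), (0x820100, 0x3610000),
      (0x3cd0200, 0x3ea0000), (0x3780400, 0x2ac0000), (0x2350800, 0x3e0000),
      (0xff1000, 0x14a0000), (0x31b2000, 0x3d60000), (0x2074000, 0x2af0000),
      (0x1d68000, 0x2270000)]]
  dual := [
    (0x3ea69ed, 0xd489b6), (0x255e25f, 0x1f8e418), (0x153f0f9, 0x2ef03c3),
    (0x1f4b49d, 0x29f4b0d), (0x3aff49c, 0x36eab74), (0x190b5f7, 0xfd4e23),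
    (0x34ee8cb, 0x11ab34c), (0x3ea2623, 0x9973df), (0x2b19e1f, 0x10f7b4), (0x358bf76, 0x1e3fba2),
    (0x1eb17e7, 0xe7ac0c), (0x32ebe7c, 0x3d8db36), (0x263e1a5, 0x3b8de69), (0xec583d, 0x7abfc3),
    (0x152be5d, 0x269496f), (0x10f3de3, 0x16071f8)]
  word := (0x10010b, 0x105)
  bound := 3
  multiplicity := 2
  excess := 0

theorem valid_26_16_6 : certificate_26_16_6.Valid 16 6 := by decide +kernel

/-- Certificate for a Hermitian LCD `[26, 17, 6]` code. -/
def certificate_26_17_6 : Certificate 26 where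
  bases := [
    List.zip [
      9, 10, 11, 12, 13, 14, 15, 16, 17, 18, 19, 20, 21, 22, 23, 24, 25] [
      (0x283, 0xab), (0x561, 0x122), (0x86f, 0x122), (0x11b5, 0x159), (0x2013, 0xd0),
      (0x40af, 0xb), (0x80e5, 0x5c), (0x1018d, 0x1a9), (0x2007b, 0x83), (0x40044, 0x17e),
      (0x80146, 0xbc), (0x1000a9, 0x1e2), (0x20017d, 0x27), (0x4001d7, 0x1d2), (0x8000b9, 0x7c),
      (0x10001b5, 0x9b), (0x2000090, 0x1c5)],
    List.zip [
      0, 1, 2, 3, 4, 5, 6, 7, 8, 18, 19, 20, 21, 22, 23, 24, 25] [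
      (0x8a01, 0x33e00), (0x28802, 0x25800), (0x22804, 0x37e00), (0x32a08, 0x27000),
      (0x21e10, 0x21a00), (0x31620, 0x30e00), (0x21e40, 0x37e00), (0x34080, 0x15800),
      (0x38700, 0x35600), (0x65c00, 0x17000), (0x87a00, 0x30600), (0x13d000, 0x7800),
      (0x200e00, 0x12600), (0x41de00, 0x20e00), (0x828c00, 0x7200), (0x1033800, 0x37800),
      (0x2006e00, 0x20800)],
    List.zip [
      0, 1, 2, 3, 4, 5, 6, 7, 8, 9, 10, 11, 12, 13, 14, 15, 16] [
      (0x380001, 0x27e0000), (0xd20002, 0x3940000), (0xb20004, 0xc80000), (0x39c0008, 0xa0000),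
      (0x1280010, 0x1b80000), (0x2b60020, 0x3080000), (0x1980040, 0x3060000),
      (0x1ce0080, 0x980000), (0x31a0100, 0x3ce0000), (0x3540200, 0x30c0000),
      (0x35e0400, 0x3920000), (0x3b80800, 0x30a0000), (0x2c41000, 0x5a0000),
      (0x3e42000, 0x30a0000), (0x15c4000, 0x2e0000), (0x168000, 0x3c20000), (0x3e90000, 0x60000)]]
  dual := [
    (0x1638d55, 0x135fd05), (0x4ba8d7, 0x1696b47), (0x691a7, 0x34ea6af), (0x822b8c, 0xf6a2e7),
    (0x3520a23, 0x23e9e6b), (0xc0638, 0xde872a), (0x33274e9, 0x3187b9c), (0x16a01a3, 0x37e076d),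
    (0xdec71a, 0x3a178d5), (0x1733315, 0x2717a0f), (0x232a89f, 0x71eccd), (0x34352ed, 0x16df2d0),
    (0x12b561, 0x11f37ab), (0x30a7ae3, 0x21d5cd6), (0x4020, 0x30250c0), (0x2e62c00, 0x2b38fa3),
    (0x9f0844, 0x1c7a96b)]
  word := (0x283, 0xab)
  bound := 3
  multiplicity := 2
  excess := 0

theorem valid_26_17_6 : certificate_26_17_6.Valid 17 6 := by decide +kernel

/-- Certificate for a Hermitian LCD `[26, 20, 4]` code. -/
def certificate_26_20_4 : Certificate 26 where
  bases := [
    List.zip [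
      0, 1, 2, 3, 4, 5, 6, 7, 8, 9, 10, 11, 12, 13, 14, 15, 16, 17, 18, 19] [
      (0x3f00001, 0x1d00000), (0x100002, 0x2b00000), (0x1f00004, 0x2f00000),
      (0xa00008, 0x1f00000), (0x3100010, 0x200000), (0x1700020, 0x3200000),
      (0x3a00040, 0x3700000), (0x1d00080, 0x2400000), (0x2200100, 0x2400000),
      (0x3400200, 0x2a00000), (0x1500400, 0x2d00000), (0x2900800, 0x2b00000),
      (0x3201000, 0x3b00000), (0x1c02000, 0x2900000), (0x3404000, 0x100000),
      (0x3608000, 0x1e00000), (0xa10000, 0x2400000), (0xa20000, 0x3700000),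
      (0x2240000, 0x1700000), (0x1380000, 0x500000)]]
  dual := [
    (0x480095, 0x78feb2), (0x3b6eee9, 0x28a042d), (0x726afb, 0x3ff1dea), (0x2014a8, 0x69edb6),
    (0x3f71ec, 0x12f81a9), (0x1f44941, 0xed129f), (0xc79232, 0x2bf5584), (0x39bb962, 0xff3e7d),
    (0x27c9aec, 0x2b4325c), (0x26d34e7, 0x24e1da1), (0x1fd58c5, 0x1a502cf),
    (0x29ff72b, 0x292028d), (0xf1ec3d, 0x3ffa3e5), (0x2f7cb1f, 0x2831189),
    (0x3c6bc7f, 0x3aa0049), (0x3cf69db, 0x2e21019), (0x3548a2c, 0x2ac34fc),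
    (0x3a1200, 0x158fad6), (0x2cf886, 0x17917f4), (0x2c1dd6e, 0x37752ff)]
  word := (0x2200100, 0x2400000)
  bound := 3
  multiplicity := 1
  excess := 0

theorem valid_26_20_4 : certificate_26_20_4.Valid 20 4 := by decide +kernel

/-- Certificate for a Hermitian LCD `[26, 21, 4]` code. -/
def certificate_26_21_4 : Certificate 26 where
  bases := [
    List.zip [
      0, 1, 2, 3, 4, 5, 6, 7, 8, 9, 10, 11, 12, 13, 14, 15, 16, 17, 18, 19, 20] [
      (0x1600001, 0xa00000), (0x600002, 0x3800000), (0x3400004, 0x0), (0x1400008, 0x1200000),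
      (0x2e00010, 0x3800000), (0x2800020, 0xe00000), (0xe00040, 0x200000),
      (0x2c00080, 0x1a00000), (0x2000100, 0x1a00000), (0x1c00200, 0x2600000),
      (0x2a00400, 0x2800000), (0x1000800, 0x1c00000), (0x3001000, 0x2600000),
      (0x3402000, 0x3800000), (0x3604000, 0x2200000), (0x2008000, 0x2c00000),
      (0x210000, 0x3e00000), (0x3620000, 0x800000), (0x2c40000, 0x2800000),
      (0x1a80000, 0x2200000), (0x3d00000, 0x2a00000)]]
  dual := [
    (0x183f09d, 0x2b7333e), (0x188311f, 0x6ba2a5), (0x2794154, 0x99392b), (0x2180be6, 0x2bc4105),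
    (0xdce016, 0x15a2f41), (0xf8c00f, 0x1891887), (0x18c271c, 0x31a0b90), (0x27233eb, 0x309b062),
    (0x1480f93, 0x23d025d), (0x3b00e9b, 0x1757d53), (0x24be150, 0x1cc7210),
    (0x1bf117c, 0x2192274), (0xefce26, 0x5906a5), (0x3d4ea44, 0x77ce97), (0xd7d23d, 0x2caa608),
    (0x14914b3, 0x26b6082), (0x30767a2, 0xd6bba7), (0x17cbcd2, 0x19e053), (0x26a5f59, 0x1492709),
    (0x3804080, 0x3e6ddfe), (0x2f151e1, 0x3633b5d)]
  word := (0x3400004, 0x0)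
  bound := 3
  multiplicity := 1
  excess := 0

theorem valid_26_21_4 : certificate_26_21_4.Valid 21 4 := by decide +kernel

/-- Certificate for a Hermitian LCD `[27, 21, 4]` code. -/
def certificate_27_21_4 : Certificate 27 where
  bases := [
    List.zip [
      0, 1, 2, 3, 4, 5, 6, 7, 8, 9, 10, 11, 12, 13, 14, 15, 16, 17, 18, 19, 20] [
      (0xc00001, 0x2e00000), (0x1c00002, 0x3200000), (0x4400004, 0x6400000),
      (0x2e00008, 0x7c00000), (0x6400010, 0x4000000), (0x3200020, 0x5e00000),
      (0x2800040, 0x5a00000), (0x1a00080, 0x5200000), (0x4a00100, 0x3800000),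
      (0x7600200, 0x5c00000), (0x7600400, 0x7e00000), (0x3000800, 0x6400000),
      (0x1001000, 0x4800000), (0x1402000, 0x1a00000), (0x6004000, 0x1000000),
      (0x2208000, 0x3600000), (0x3610000, 0x4800000), (0x2420000, 0x3e00000),
      (0x3a40000, 0x4800000), (0x480000, 0x6000000), (0x1900000, 0x400000)]]
  dual := [
    (0x469d1cb, 0x4e7d35a), (0xcdeaf2, 0x1b10185), (0xcd4e6e, 0x7228922), (0x17fa3c, 0x75991d1),
    (0x6499873, 0x7bbc69), (0x21afa6a, 0x663a5d4), (0x9b1f0e, 0x2257eb9), (0x14e9669, 0x7b3586a),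
    (0x54e376e, 0x41d302f), (0x22a85af, 0x7ab1841), (0x15e5fb4, 0x7ec870),
    (0x456baaa, 0x79926d4), (0x5ed2e20, 0x4e203d9), (0x51d705a, 0x738c970),
    (0x43fc0ee, 0x1e024c1), (0x605ee86, 0x715243d), (0x1627ba4, 0x4868bfb),
    (0x1d0595d, 0x2a116b5), (0x25578cf, 0xa98541), (0x14c58ef, 0x4842f18), (0x256c1f2, 0x6c0ad9a)]
  word := (0x4400004, 0x6400000)
  bound := 3
  multiplicity := 1
  excess := 0

theorem valid_27_21_4 : certificate_27_21_4.Valid 21 4 := by decide +kernel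

/-- Certificate for a Hermitian LCD `[27, 22, 4]` code. -/
def certificate_27_22_4 : Certificate 27 where
  bases := [
    List.zip [
      0, 1, 2, 3, 4, 5, 6, 7, 8, 9, 10, 11, 12, 13, 14, 15, 16, 17, 18, 19, 20, 21] [
      (0x1000001, 0x5400000), (0x7800002, 0x1c00000), (0x2000004, 0x7800000),
      (0x1800008, 0x1c00000), (0x1400010, 0x2000000), (0x6000020, 0x7000000),
      (0x1800040, 0x5800000), (0xc00080, 0x6000000), (0x2800100, 0x6400000),
      (0x2c00200, 0x5000000), (0x3800400, 0x3800000), (0x5c00800, 0x3000000),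
      (0x7801000, 0x800000), (0x3402000, 0x3c00000), (0x4404000, 0x4800000),
      (0x6408000, 0x1400000), (0x6810000, 0x400000), (0x7c20000, 0x7c00000),
      (0xc40000, 0x2400000), (0x1880000, 0x7400000), (0x6100000, 0x5800000),
      (0x2600000, 0x7000000)]]
  dual := [
    (0x7b8745b, 0x269e9c6), (0x70264f6, 0x3985489), (0x330dde7, 0xfd7681),
    (0x7ac1a03, 0x44986c2), (0x29d2443, 0xd5aca0), (0x504dc96, 0xe918d0), (0x53083e, 0x41c7929),
    (0x4af3f99, 0x66eb23f), (0x6a0d0c5, 0x6cf8041), (0x171ec04, 0x4a9c88c),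
    (0x502c2a9, 0x646681e), (0x4325c9d, 0x67cc671), (0x72794b, 0x350c0e6),
    (0x3777646, 0x7d884d5), (0x144a160, 0x5c51e47), (0x25a7cbd, 0x2123b99),
    (0x35e61ed, 0x344433d), (0x5553942, 0x1ec8580), (0x3542d6c, 0x63b4dd4),
    (0x46fab76, 0x1d62bef), (0x42b0203, 0x5acb856), (0x28e3128, 0x7160aa5)]
  word := (0x1000001, 0x5400000)
  bound := 3
  multiplicity := 1
  excess := 0

theorem valid_27_22_4 : certificate_27_22_4.Valid 22 4 := by decide +kernel

/-- Certificate for a Hermitian LCD `[28, 21, 4]` code. -/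
def certificate_28_21_4 : Certificate 28 where
  bases := [
    List.zip [
      0, 1, 2, 3, 4, 5, 6, 7, 8, 9, 10, 11, 12, 13, 14, 15, 16, 17, 18, 19, 20] [
      (0x9a00001, 0xe400000), (0xf000002, 0x7200000), (0xfe00004, 0x5200000),
      (0x9400008, 0x7600000), (0xcc00010, 0xd600000), (0x6e00020, 0x1000000),
      (0xd600040, 0xfa00000), (0x7000080, 0x1600000), (0x5e00100, 0xc600000),
      (0xd400200, 0x8000000), (0x7000400, 0x9c00000), (0x8a00800, 0x7200000),
      (0x9c01000, 0x800000), (0xb402000, 0x8200000), (0xc804000, 0xc800000),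
      (0x408000, 0xde00000), (0xa210000, 0xba00000), (0x2a20000, 0x5200000),
      (0xc040000, 0xd400000), (0xa680000, 0x5800000), (0x3700000, 0xd200000)]]
  dual := [
    (0x959fca4, 0x521976a), (0xa9cdbc5, 0x8104105), (0xa5a7e29, 0x3a229ba),
    (0xa0ee879, 0x2d521f5), (0x2ae2d74, 0x78cfcc), (0x7a8cdb0, 0x3a8734d),
    (0xdd5c463, 0xfa28db9), (0x12ecff, 0x52f795c), (0x9d867cd, 0xfdffeff),
    (0xf087637, 0x2ef6d31), (0xf9594a4, 0x7917351), (0x32b1b6b, 0x275b3d4),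
    (0x7a633a6, 0xaed8da1), (0xe98bc31, 0xc0acfac), (0xf94a45d, 0x660a7b2),
    (0xb99dba, 0x7ac7951), (0xc6793c8, 0x9b81f89), (0x3f3b58, 0xbf423c4), (0x465cfd2, 0xfb29b88),
    (0xd5b188f, 0xf71b3b0), (0x945e8dd, 0xef0d1a)]
  word := (0xc804000, 0xc800000)
  bound := 3
  multiplicity := 1
  excess := 0

theorem valid_28_21_4 : certificate_28_21_4.Valid 21 4 := by decide +kernel

/-- Certificate for a Hermitian LCD `[28, 22, 4]` code. -/
def certificate_28_22_4 : Certificate 28 where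
  bases := [
    List.zip [
      0, 1, 2, 3, 4, 5, 6, 7, 8, 9, 10, 11, 12, 13, 14, 15, 16, 17, 18, 19, 20, 21] [
      (0xf400001, 0x8c00000), (0xfc00002, 0x1800000), (0xf400004, 0x5c00000),
      (0xb800008, 0x5000000), (0xcc00010, 0xc000000), (0xec00020, 0x5800000),
      (0x6c00040, 0xcc00000), (0x5c00080, 0x9800000), (0x6000100, 0xd000000),
      (0x9800200, 0x400000), (0xc000400, 0x1000000), (0xfc00800, 0xac00000),
      (0x3001000, 0x6800000), (0x2802000, 0x9c00000), (0xa004000, 0x3000000),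
      (0xd808000, 0x7000000), (0x5410000, 0x7000000), (0x3c20000, 0xac00000),
      (0x8040000, 0x2400000), (0x5c80000, 0xd400000), (0x9d00000, 0x5000000),
      (0x2600000, 0xf400000)]]
  dual := [
    (0x3571c1a, 0x288c47e), (0xd91f6bc, 0x290b671), (0x3a506bf, 0xe583719),
    (0x97dae0a, 0xb10cbe5), (0x5f1f950, 0x576e87), (0xd420f4d, 0x497504b),
    (0xa53f69b, 0xc4590ab), (0x2dd929e, 0x4e3e558), (0xf077abc, 0x5649a8c),
    (0x8abf2f0, 0xf0cb11e), (0x9c0d8f8, 0x9aa2097), (0xcf35421, 0x37d4118),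
    (0x1266cb5, 0x8562366), (0xf0ce5cc, 0x2b55696), (0x60a57eb, 0xce2a8b9),
    (0x6b7e511, 0xe5843cb), (0xc39a32f, 0xeb628f0), (0x98b8fd1, 0xf3554b0),
    (0xe538afd, 0x2433b70), (0xe73ec8d, 0x7b08e05), (0x6f630e5, 0x30bb83e), (0x752f79c, 0x34b6d80)]
  word := (0xc000400, 0x1000000)
  bound := 3
  multiplicity := 1
  excess := 0

theorem valid_28_22_4 : certificate_28_22_4.Valid 22 4 := by decide +kernel

/-- Certificate for a Hermitian LCD `[28, 23, 4]` code. -/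
def certificate_28_23_4 : Certificate 28 where
  bases := [
    List.zip [
      0, 1, 2, 3, 4, 5, 6, 7, 8, 9, 10, 11, 12, 13, 14, 15, 16, 17, 18, 19, 20, 21, 22] [
      (0x8000001, 0xe000000), (0xc800002, 0xd800000), (0x800004, 0x9800000),
      (0xd800008, 0x7000000), (0x5800010, 0x7800000), (0x1800020, 0xf000000),
      (0x4800040, 0xc800000), (0xb800080, 0xf800000), (0x6000100, 0x7800000),
      (0x2800200, 0x7000000), (0xf000400, 0x800000), (0xd000800, 0xa000000),
      (0xc801000, 0x800000), (0x6002000, 0xf000000), (0x2004000, 0xd000000),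
      (0xb808000, 0x9800000), (0x9810000, 0x1800000), (0xa820000, 0x6000000),
      (0xf840000, 0x8800000), (0x7880000, 0x8000000), (0x7900000, 0xe800000),
      (0x6200000, 0x800000), (0x9c00000, 0xe800000)]]
  dual := [
    (0x6dcab9b, 0x7f51908), (0xe9b3713, 0xfee6d64), (0x861c15e, 0xba78daa),
    (0x7b5680, 0xaa6e9f5), (0x91bbbdf, 0xe184d08), (0x8141cee, 0xd7ac58e),
    (0xe62f87e, 0xcf8938a), (0x414a355, 0xdabdc6c), (0x24a90e8, 0x3eed27f),
    (0x2bdd7db, 0xc838d40), (0x780c09c, 0x7f4fab6), (0x6a65eee, 0xa0ca69f),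
    (0xcd1febb, 0xa0265c1), (0x263ccd9, 0xb76dc0a), (0x72acbf6, 0x183b5ba),
    (0xb811839, 0x6786fec), (0xb8ff09b, 0xb5e4285), (0x2461af4, 0xf9573ae),
    (0x67c27ae, 0xbfb2d0f), (0xf10cae9, 0xf4589f2), (0x5dbb6ca, 0x547a471),
    (0x120cfa3, 0xe44a5ef), (0xdeb942e, 0xfbda563)]
  word := (0x8000001, 0xe000000)
  bound := 3
  multiplicity := 1
  excess := 0

theorem valid_28_23_4 : certificate_28_23_4.Valid 23 4 := by decide +kernel

/-- Certificate for a Hermitian LCD `[29, 22, 4]` code. -/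
def certificate_29_22_4 : Certificate 29 where
  bases := [
    List.zip [
      0, 1, 2, 3, 4, 5, 6, 7, 8, 9, 10, 11, 12, 13, 14, 15, 16, 17, 18, 19, 20, 21] [
      (0x13000001, 0x1ec00000), (0x9c00002, 0x5c00000), (0xb400004, 0x18400000),
      (0x16000008, 0xec00000), (0x14400010, 0x19c00000), (0x1dc00020, 0x18000000),
      (0x1c000040, 0xec00000), (0x17400080, 0xd400000), (0x14400100, 0x6c00000),
      (0x1d400200, 0x17400000), (0x5000400, 0xc00000), (0xc400800, 0x3800000),
      (0x11801000, 0x15400000), (0x5802000, 0xb800000), (0x4404000, 0x1fc00000),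
      (0x12c08000, 0x3800000), (0x6c10000, 0x1d400000), (0x420000, 0x1f000000),
      (0x7040000, 0x1b800000), (0x1a480000, 0x13800000), (0x1a900000, 0x6800000),
      (0x9200000, 0x3400000)]]
  dual := [
    (0x28e9e1b, 0x111ea34c), (0x1428744f, 0xcfb1ff4), (0x186122f5, 0x75e7773),
    (0x11eb2242, 0x1253cae1), (0x184c9a63, 0x1469806), (0x1710d19a, 0xa289ace),
    (0x12b40bb1, 0x385522f), (0xac0e5ce, 0x19912e2a), (0x1d2c95e7, 0xfa1f807),
    (0x140f52b2, 0x173fcef), (0xb6705, 0x1ae76286), (0x1e035beb, 0x788e3ba),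
    (0x1db0c845, 0xc84a376), (0x1949db0b, 0x69f85), (0x108631ee, 0x820f4c),
    (0x1d568a88, 0x9423b39), (0x19ae29c6, 0x5c007ca), (0x44b2816, 0x18c8e61f),
    (0x1049f704, 0x17d03455), (0x17052f3c, 0xf420827), (0x1e9492ef, 0xc04028f),
    (0x1f01166c, 0xb400722)]
  -- This word is not a row: it is row 1 plus `ω` times row 10, counting rows from 0.
  word := (0x9000002, 0x400)
  bound := 3
  multiplicity := 1
  excess := 0

theorem valid_29_22_4 : certificate_29_22_4.Valid 22 4 := by decide +kernel

/-- Certificate for a Hermitian LCD `[29, 23, 4]` code. -/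
def certificate_29_23_4 : Certificate 29 where
  bases := [
    List.zip [
      0, 1, 2, 3, 4, 5, 6, 7, 8, 9, 10, 11, 12, 13, 14, 15, 16, 17, 18, 19, 20, 21, 22] [
      (0x1b800001, 0x14000000), (0x19800002, 0x19800000), (0x12800004, 0x12000000),
      (0x1e000008, 0x3000000), (0x800010, 0x15800000), (0xe800020, 0x16800000),
      (0x1800040, 0x11000000), (0xc800080, 0x9800000), (0x1000100, 0x15000000),
      (0x13000200, 0x7800000), (0x17800400, 0x12000000), (0xd800800, 0x17000000),
      (0x13001000, 0x14800000), (0x1f802000, 0x13000000), (0x15804000, 0x16000000),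
      (0x2808000, 0xa800000), (0xe810000, 0x5000000), (0x1c820000, 0x4800000),
      (0x1c040000, 0x8800000), (0x1f880000, 0x11800000), (0x3100000, 0x11000000),
      (0x9200000, 0x18800000), (0x14400000, 0x5800000)]]
  dual := [
    (0xd36a9f3, 0xded27de), (0x173c2e3e, 0xf636edd), (0x1915becd, 0xcae7edb),
    (0x14257401, 0x1e4ca267), (0xe482864, 0x10a2af67), (0x76702cb, 0x98625d8),
    (0x16c3ccca, 0x194c7b3f), (0x182a742, 0x1d21f427), (0x432c6f0, 0xd1b6071),
    (0x1b4fbff9, 0x8e1fc5f), (0x15c94579, 0x3e6bab7), (0xe3c2c01, 0x1747e656),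
    (0x1c7184c8, 0x5fa6c4), (0x160bb560, 0x1fffdfff), (0x10f4ee8e, 0xc36abc6),
    (0x8ad0d5d, 0x4057e98), (0xf640def, 0x750bb83), (0x17245ed7, 0xa147d36),
    (0x1353642, 0xd8afc6d), (0xd849f5f, 0x13b4314d), (0x11f2807, 0x2cb7100),
    (0x17afbfbc, 0x1fc86697), (0x1df0683b, 0x19313e4b)]
  word := (0x12800004, 0x12000000)
  bound := 3
  multiplicity := 1
  excess := 0

theorem valid_29_23_4 : certificate_29_23_4.Valid 23 4 := by decide +kernel

/-- Certificate for a Hermitian LCD `[30, 23, 4]` code. -/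
def certificate_30_23_4 : Certificate 30 where
  bases := [
    List.zip [
      0, 1, 2, 3, 4, 5, 6, 7, 8, 9, 10, 11, 12, 13, 14, 15, 16, 17, 18, 19, 20, 21, 22] [
      (0x11000001, 0x7000000), (0x23000002, 0x1c800000), (0xa000004, 0x24800000),
      (0x2b000008, 0x1d000000), (0x20000010, 0x29800000), (0x27000020, 0xb000000),
      (0x39000040, 0xc000000), (0x2a000080, 0x2f800000), (0x1a000100, 0x1e000000),
      (0x34000200, 0x27800000), (0x18800400, 0x8000000), (0x35000800, 0x18000000),
      (0x12801000, 0x14000000), (0x9002000, 0xb800000), (0x12804000, 0x3b800000),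
      (0x7808000, 0x19000000), (0x15010000, 0x13800000), (0x14820000, 0x10000000),
      (0x7040000, 0x10000000), (0x20880000, 0x3e800000), (0x24900000, 0x33000000),
      (0x37a00000, 0x35000000), (0x16400000, 0x1d000000)]]
  dual := [
    (0x133a9a24, 0x3f7adb80), (0x3c9815e6, 0x2dbede40), (0x20bc1a4f, 0x3f5ca390),
    (0x19dc6a0c, 0x12f2ee30), (0x3390076c, 0x3d2f2a2c), (0x2c207d0b, 0x3eea4358),
    (0x11016cf4, 0x21139922), (0x33d11a47, 0x32a32805), (0x3908f057, 0x2eef3465),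
    (0x2e7308a2, 0x23c2783f), (0x3a271978, 0x1666110a), (0xd6d1436, 0x3cc732db),
    (0x91c92e4, 0x390f43), (0x1cceaaf4, 0x361e4b9c), (0x20f2a343, 0xfbd222b),
    (0x4bd714e, 0x2c94004f), (0x104dd710, 0x243059d0), (0x150449fa, 0xd342ffb),
    (0x3635511a, 0x19caed16), (0x12b5c838, 0x15e47137), (0x316f22d0, 0x1f63f04f),
    (0x679b9e, 0x305b55bb), (0x1f4d65a5, 0x15bc0f2d)]
  word := (0x18800400, 0x8000000)
  bound := 3
  multiplicity := 1
  excess := 0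

theorem valid_30_23_4 : certificate_30_23_4.Valid 23 4 := by decide +kernel

/-- Certificate for a Hermitian LCD `[30, 24, 4]` code. -/
def certificate_30_24_4 : Certificate 30 where
  bases := [
    List.zip [
      0, 1, 2, 3, 4, 5, 6, 7, 8, 9, 10, 11, 12, 13, 14, 15, 16, 17, 18, 19, 20, 21, 22, 23] [
      (0x22000001, 0x3e000000), (0x22000002, 0x16000000), (0x38000004, 0x1d000000),
      (0x2f000008, 0x19000000), (0xf000010, 0x1f000000), (0x2a000020, 0x19000000),
      (0x21000040, 0x1b000000), (0xe000080, 0x30000000), (0x27000100, 0x16000000),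
      (0x3c000200, 0x25000000), (0x3d000400, 0x2c000000), (0x22000800, 0xf000000),
      (0x3d001000, 0x1b000000), (0x9002000, 0x20000000), (0x28004000, 0x4000000),
      (0xa008000, 0x2b000000), (0x2d010000, 0x4000000), (0x9020000, 0x3d000000),
      (0x35040000, 0x33000000), (0x26080000, 0x11000000), (0x38100000, 0x1b000000),
      (0x31200000, 0xe000000), (0x12400000, 0xa000000), (0x15800000, 0x1d000000)]]
  dual := [
    (0x2da7c405, 0x2940731c), (0x12c806ee, 0x101e9ea8), (0x33f70eca, 0x4ffa3c9),
    (0x13e9bd11, 0xa2f6dd7), (0x344273e1, 0x511daa9), (0x8e7cc60, 0x20cfc312),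
    (0x2248ffa, 0xb88d30c), (0xb35a548, 0x26e05e1e), (0x9c676b5, 0x3afe306d),
    (0x39fb8da1, 0x33d244f7), (0x9b26165, 0x29e59a8a), (0xcecd6f6, 0x2ebae49a),
    (0x39aa4ccb, 0x3f4ca5d3), (0x25583c95, 0x1320d90d), (0x366637c8, 0x1fca2af9),
    (0x24e7369f, 0x19e53c76), (0x2d690691, 0x352a843c), (0xb299c1b, 0xd214b2e),
    (0x36085ccb, 0x2710952e), (0x9d66364, 0x2051596e), (0x22b42d92, 0x15ac0b16),
    (0x16c07361, 0x21d3ad8c), (0xb013c9b, 0x24a8d7a5), (0x2e4850cb, 0x1170cfe4)]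
  word := (0x9002000, 0x20000000)
  bound := 3
  multiplicity := 1
  excess := 0

theorem valid_30_24_4 : certificate_30_24_4.Valid 24 4 := by decide +kernel

end QuaternaryLCD

/-! ### The theorem for all parameters and all `s` -/

open QuaternaryLCD

theorem mainTheorem7 {F : Type*} [Field F] [Fintype F] [DecidableEq F]
    (hF : Fintype.card F = 4) (n k d : ℕ) (h : (n, k, d) ∈ QuaternaryLCD.paramSet) (s : ℕ) :
    ∃ C : Submodule F (Fin (n + (4 ^ k - 1) / 3 * s) → F),
      QuaternaryLCD.IsCode (n + (4 ^ k - 1) / 3 * s) k (d + 4 ^ (k - 1) * s) C ∧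
      QuaternaryLCD.IsHermitianLCD 2 C := by
  obtain ⟨ω, hω⟩ := exists_isGenerator hF
  simp only [paramSet, Set.mem_insert_iff, Set.mem_singleton_iff, Prod.mk.injEq] at h
  obtain ⟨hk, C, hC, hL⟩ : 2 ≤ k ∧ ∃ C : Submodule F (Fin n → F),
      IsCode n k d C ∧ IsHermitianLCD 2 C := by
    rcases h with ⟨rfl, rfl, rfl⟩ | ⟨rfl, rfl, rfl⟩ | ⟨rfl, rfl, rfl⟩ | ⟨rfl, rfl, rfl⟩ | ⟨rfl, rfl, rfl⟩ |
      ⟨rfl, rfl, rfl⟩ | ⟨rfl, rfl, rfl⟩ | ⟨rfl, rfl, rfl⟩ | ⟨rfl, rfl, rfl⟩ | ⟨rfl, rfl, rfl⟩ |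
      ⟨rfl, rfl, rfl⟩ | ⟨rfl, rfl, rfl⟩ | ⟨rfl, rfl, rfl⟩ | ⟨rfl, rfl, rfl⟩ | ⟨rfl, rfl, rfl⟩ |
      ⟨rfl, rfl, rfl⟩ | ⟨rfl, rfl, rfl⟩ | ⟨rfl, rfl, rfl⟩ | ⟨rfl, rfl, rfl⟩ | ⟨rfl, rfl, rfl⟩ |
      ⟨rfl, rfl, rfl⟩
    · exact ⟨by norm_num, Certificate.exists_code hω valid_21_8_9⟩
    · exact ⟨by norm_num, Certificate.exists_code hω valid_21_10_8⟩
    · exact ⟨by norm_num, Certificate.exists_code hω valid_21_11_7⟩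
    · exact ⟨by norm_num, Certificate.exists_code hω valid_22_8_10⟩
    · exact ⟨by norm_num, Certificate.exists_code hω valid_23_18_4⟩
    · exact ⟨by norm_num, Certificate.exists_code hω valid_24_16_6⟩
    · exact ⟨by norm_num, Certificate.exists_code hω valid_25_18_4⟩
    · exact ⟨by norm_num, Certificate.exists_code hω valid_25_19_4⟩
    · exact ⟨by norm_num, Certificate.exists_code hω valid_26_16_6⟩
    · exact ⟨by norm_num, Certificate.exists_code hω valid_26_17_6⟩
    · exact ⟨by norm_num, Certificate.exists_code hω valid_26_20_4⟩
    · exact ⟨by norm_num, Certificate.exists_code hω valid_26_21_4⟩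
    · exact ⟨by norm_num, Certificate.exists_code hω valid_27_21_4⟩
    · exact ⟨by norm_num, Certificate.exists_code hω valid_27_22_4⟩
    · exact ⟨by norm_num, Certificate.exists_code hω valid_28_21_4⟩
    · exact ⟨by norm_num, Certificate.exists_code hω valid_28_22_4⟩
    · exact ⟨by norm_num, Certificate.exists_code hω valid_28_23_4⟩
    · exact ⟨by norm_num, Certificate.exists_code hω valid_29_22_4⟩
    · exact ⟨by norm_num, Certificate.exists_code hω valid_29_23_4⟩
    · exact ⟨by norm_num, Certificate.exists_code hω valid_30_23_4⟩
    · exact ⟨by norm_num, Certificate.exists_code hω valid_30_24_4⟩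
  exact exists_simplex_extension hF hω hk hC hL s
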